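/- Let $d\ge 1$ and let $X=\{1,\dots,d\}^{\mathbb N}$ carry the metric $d_\theta(x,y)=\theta^{n}$, where $0<\theta<1$ and $n\ge1$ is the first index with $x_n\ne y_n$ (and $d_\theta(x,x)=0$). For $x\in X$ write $j*x=(j,x_1,x_2,\dots)$. Let $\sim$ be an equivalence relation on $X$ with finite classes $[x]$, and suppose that it has a continuous representation $\psi$: for each $1\le j\le d$ there are a number $k_j$ and continuous maps $x\mapsto\psi_i(j*x)$, $1\le i\le k_j$, from $X$ to $X$, such that for every $x$ the points $\psi_1(j*x),\dots,\psi_{k_j}(j*x)$ are pairwise distinct and $[j*x]=\{\psi_1(j*x),\dots,\psi_{k_j}(j*x)\}$. Assume that the representation is Lipschitz with $\max_{i,j}\mathrm{Lip}(\psi_i(j*\cdot))<1$. Let $G=\{(x,y)\in X^2: x\sim y\}$, let $\nu^x$ be the counting measure on $[x]$, let $V:X\to\mathbb R$ be $\alpha$-Hölder for some $\alpha>0$, let $c(x,y)=V(y)-V(x)$ for $(x,y)\in G$, and let $\beta\in\mathbb R$. Consider the iterated function system with weights $$R=\bigl(X,\ \tau_{ij},\ q_{ij}\bigr),\qquad \tau_{ij}(x)=\psi_i(j*x),\quad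 q_{ij}(x)=e^{-\beta V(\psi_i(j*x))},$$ and the operator $B_R(f)(x)=\sum_{i,j}q_{ij}(x)f(\tau_{ij}(x))$. Then: 1. $R$ is contractive: there is $L<1$ with $d_\theta(\tau_{ij}(x),\tau_{ij}(z))\le L\,d_\theta(x,z)$ for all $i,j,x,z$. 2. The weights are Dini continuous: $\int_0^1\sup_{d_\theta(x,z)\le t}\frac{|\ln q_{ij}(x)-\ln q_{ij}(z)|}{t}\,dt<\infty$ for all $i,j$. 3. There is a unique non-empty compact set $K\subset X$ (the attractor) with $\bigcup_{i,j}\tau_{ij}(K)=K$. The spectral radius $\rho$ of $B_R$ acting on $C(K)$ is positive, and there are a unique $h\in C(K)$, $h>0$, and a unique Borel probability $\mu$ on $K$ with $B_R(h)=\rho h$, $B_R^*(\mu)=\rho\mu$ and $\int h\,d\mu=1$. 4. This eigenmeasure $\mu$, regarded as a probability $M$ on $X$, is $(c,\beta)$-quasi-invariant: for every Borel function $g:G\to\mathbb R$ with $\int\int|g(s,x)|\,d\nu^x(s)\,dM(x)<\infty$, the right-hand side below converges absolutely and $$\int\int g(s,x)\,d\nu^x(s)\,dM(x)=\int\int g(x,s)\,e^{-\beta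 c(x,s)}\,d\nu^x(s)\,dM(x).$$ -/

import Mathlib

open MeasureTheory
open scoped ENNReal

/-! ### The symbolic space -/

/-- The symbolic space of one-sided sequences over an alphabet with `d` symbols
(product topology, Borel sigma-algebra). -/
abbrev SymbolicSpace (d : ℕ) : Type := ℕ → Fin d

/-- The concatenation `j * x = (j, x₁, x₂, …)`. -/
def concat {d : ℕ} (j : Fin d) (x : SymbolicSpace d) : SymbolicSpace d
  | 0 => j
  | n + 1 => x n

/-- The usual metric: `θ ^ n` where `n ≥ 1` is the first (1-based) position at which the two
sequences differ. -/
noncomputable def symDist {d : ℕ} (θ : ℝ) (x y : SymbolicSpace d) : ℝ :=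
  open Classical in if x = y then 0 else θ ^ (PiNat.firstDiff x y + 1)

/-! ### Representations of an equivalence relation, cocycles, quasi-invariance -/

/-- `ψ j i x` stands for `ψ_i(j * x)`: for all `j` and `x`, the points
`ψ_1(j * x), …, ψ_k(j * x)` list the equivalence class `[j * x]` without repetition. The number `k`
of elements may depend on `j`. -/
def IsRepresentation {d : ℕ} (r : Setoid (SymbolicSpace d)) {k : Fin d → ℕ}
    (ψ : (j : Fin d) → Fin (k j) → C(SymbolicSpace d, SymbolicSpace d)) : Prop :=
  ∀ (j : Fin d) (x : SymbolicSpace d),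
    Function.Injective (fun i => ψ j i x) ∧
      Set.range (fun i => ψ j i x) = {s | r s (concat j x)}

/-- `c(x, y) = V(y) - V(x)` on the groupoid `{(x, y) | x ∼ y}`. Values of `c` off the groupoid
play no role. -/
def IsSeparableCocycle {d : ℕ} (r : Setoid (SymbolicSpace d))
    (c : SymbolicSpace d → SymbolicSpace d → ℝ) (V : SymbolicSpace d → ℝ) : Prop :=
  ∀ x y, r x y → c x y = V y - V x

/-- The transverse function: `ν^x` is the counting measure on the class `[x]`. -/
noncomputable def transverse {d : ℕ} (r : Setoid (SymbolicSpace d)) (x : SymbolicSpace d) :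
    Measure (SymbolicSpace d) :=
  Measure.count.restrict {s | r s x}

/-- The `(c, β)`-quasi-invariant condition. The test function `h` lives on the groupoid
`G = {(x, y) | x ∼ y}` (it is extended to `X × X` in an arbitrary way, which does not affect any of
the integrals); it is Borel on `G`, and integrable in the sense that the left-hand double integral
converges absolutely. The right-hand one is required to converge absolutely and to be equal to
it. -/
def IsQuasiInvariant {d : ℕ} (r : Setoid (SymbolicSpace d))
    (c : SymbolicSpace d → SymbolicSpace d → ℝ) (β : ℝ)
    (M : ProbabilityMeasure (SymbolicSpace d)) : Prop :=
  ∀ h : SymbolicSpace d → SymbolicSpace d → ℝ,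
    Measurable (fun p : {p : SymbolicSpace d × SymbolicSpace d // r p.1 p.2} =>
      h p.1.1 p.1.2) →
    (∫⁻ x, ∫⁻ s, ‖h s x‖ₑ ∂(transverse r x) ∂(M : Measure (SymbolicSpace d))) < ∞ →
    (∫⁻ x, ∫⁻ s, ‖h x s * Real.exp (-β * c x s)‖ₑ ∂(transverse r x)
        ∂(M : Measure (SymbolicSpace d))) < ∞ ∧
      ∫ x, ∫ s, h s x ∂(transverse r x) ∂(M : Measure (SymbolicSpace d)) =
        ∫ x, ∫ s, h x s * Real.exp (-β * c x s) ∂(transverse r x)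
          ∂(M : Measure (SymbolicSpace d))

/-! ### Iterated function systems with weights -/

/-- An iterated function system with positive weights `(Y, τ_i, q_i)`. -/
structure WeightedIFS (Y ι : Type*) [TopologicalSpace Y] where
  map : ι → C(Y, Y)
  weight : ι → C(Y, ℝ)
  weight_pos : ∀ i y, 0 < weight i y

namespace WeightedIFS

variable {Y ι : Type*} [TopologicalSpace Y]

/-- The maps are uniformly contracting for the distance function `D`. -/
def IsContractive (R : WeightedIFS Y ι) (D : Y → Y → ℝ) : Prop :=
  ∃ L : ℝ, 0 ≤ L ∧ L < 1 ∧ ∀ i y z, D (R.map i y) (R.map i z) ≤ L * D y z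

/-- Dini continuity of the weights:
`∫_0^1 sup_{D(y,z) ≤ t} |ln q_i(y) - ln q_i(z)| / t dt < ∞` for each `i`. -/
def HasDiniWeights (R : WeightedIFS Y ι) (D : Y → Y → ℝ) : Prop :=
  ∀ i, (∫⁻ t in Set.Ioc (0 : ℝ) 1, ⨆ (y : Y) (z : Y) (_ : D y z ≤ t),
    ENNReal.ofReal (|Real.log (R.weight i y) - Real.log (R.weight i z)| / t)) < ∞

/-- The non-empty compact set `K` satisfies `⋃ τ_i(K) = K`. -/
def IsAttractor (R : WeightedIFS Y ι) (K : TopologicalSpace.NonemptyCompacts Y) : Prop :=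
  ⋃ i, R.map i '' (K : Set Y) = (K : Set Y)

theorem IsAttractor.map_mem {R : WeightedIFS Y ι} {K : TopologicalSpace.NonemptyCompacts Y}
    (hK : R.IsAttractor K) (i : ι) (y : K) : R.map i y ∈ K := by
  have h : R.map i y ∈ ⋃ i, R.map i '' (K : Set Y) :=
    Set.mem_iUnion.2 ⟨i, Set.mem_image_of_mem _ y.2⟩
  rw [show _ = _ from hK] at h
  exact h

/-- The restriction of the system to an attractor. -/
def restrict (R : WeightedIFS Y ι) (K : TopologicalSpace.NonemptyCompacts Y)
    (hK : R.IsAttractor K) : WeightedIFS K ι where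
  map i := ⟨fun y => ⟨R.map i y, hK.map_mem i y⟩, by fun_prop⟩
  weight i := ⟨fun y => R.weight i y, by fun_prop⟩
  weight_pos i y := R.weight_pos i y

/-- The operator `B_R(f)(y) = ∑ q_i(y) f(τ_i y)` on continuous functions with values in `𝕜`. -/
noncomputable def transfer [CompactSpace Y] [Fintype ι] (R : WeightedIFS Y ι) (𝕜 : Type*) [RCLike 𝕜] :
    C(Y, 𝕜) →L[𝕜] C(Y, 𝕜) where
  toFun f := ∑ i, (⟨fun y => (R.weight i y : 𝕜), by fun_prop⟩ : C(Y, 𝕜)) * f.comp (R.map i)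
  map_add' f g := by
    simp only [ContinuousMap.add_comp, mul_add, Finset.sum_add_distrib]
  map_smul' a f := by
    simp only [ContinuousMap.smul_comp, mul_smul_comm, Finset.smul_sum, RingHom.id_apply]
  cont := continuous_finsetSum _ fun i _ =>
    continuous_const.mul (ContinuousMap.continuous_precomp (R.map i))

theorem transfer_apply [CompactSpace Y] [Fintype ι] (R : WeightedIFS Y ι) (𝕜 : Type*) [RCLike 𝕜]
    (f : C(Y, 𝕜)) (y : Y) :
    R.transfer 𝕜 f y = ∑ i, (R.weight i y : 𝕜) * f (R.map i y) := by
  simp [transfer]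

/-- The spectral radius `ρ` of `B_R`, computed on complex-valued continuous functions. -/
noncomputable def rho [CompactSpace Y] [Fintype ι] (R : WeightedIFS Y ι) : ℝ :=
  (spectralRadius ℂ (R.transfer ℂ)).toReal

/-- `h > 0`, `B_R(h) = ρ h`, `B_R^*(μ) = ρ μ` and `∫ h dμ = 1`. -/
structure IsPerronPair [CompactSpace Y] [Fintype ι] [MeasurableSpace Y] (R : WeightedIFS Y ι)
    (h : C(Y, ℝ)) (μ : ProbabilityMeasure Y) : Prop where
  pos : ∀ y, 0 < h y
  eigenfunction : R.transfer ℝ h = R.rho • h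
  eigenmeasure : ∀ f : C(Y, ℝ),
    ∫ y, R.transfer ℝ f y ∂(μ : Measure Y) = R.rho * ∫ y, f y ∂(μ : Measure Y)
  normalized : ∫ y, h y ∂(μ : Measure Y) = 1

end WeightedIFS

/-- The weighted system `(X, ψ_i(j * ·), e^{-β V(ψ_i(j * ·))})`, indexed by the pairs `(j, i)`. -/
noncomputable def haarIFS {d : ℕ} {k : Fin d → ℕ}
    (ψ : (j : Fin d) → Fin (k j) → C(SymbolicSpace d, SymbolicSpace d))
    (V : C(SymbolicSpace d, ℝ)) (β : ℝ) :
    WeightedIFS (SymbolicSpace d) ((j : Fin d) × Fin (k j)) where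
  map p := ψ p.1 p.2
  weight p := ⟨fun x => Real.exp (-β * V (ψ p.1 p.2 x)), by fun_prop⟩
  weight_pos _ _ := Real.exp_pos _

/-!
The weights have bounded distortion and the maps contract, so for large `A` the operator `B_R`
sends the cone of functions with `A`-Lipschitz logarithm (for the gauge `d_θ ^ α`) into the cone
with constant `A - 1`. As in Birkhoff's theorem on positive operators, if
`m B_R ^ n 1 ≤ B_R ^ n g ≤ M B_R ^ n 1` in the order of the cone, then the same holds at `n + 1`
with `M - m` reduced by a fixed factor. By density of Lipschitz functions the ratios
`B_R ^ n g / B_R ^ n 1` converge uniformly, for every continuous `g`, to a constant, which is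
`∫ g dμ` for a probability `μ`. This `μ` is the only eigenmeasure; with `l` its eigenvalue,
`l ^ (-n) B_R ^ n 1` converges to a positive eigenfunction, the only one up to scaling. A positive
eigenfunction makes the powers of `l⁻¹ B_R` bounded, whence `ρ = l`.

For the quasi-invariance, `∑_{i,j} q_{ij}(x) ∫ g(τ_{ij} x, s) dν(s)`, with `ν` counting the class of
`τ_{ij} x`, is the sum over `j` of the double sums of `e ^ (-β V(y)) g(y, s)` over `y, s ∈ [j * x]`.
Exchanging `y` and `s` costs the factor `e ^ (-β c(y, s))`, and integrating against the eigenmeasure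
carries this symmetry over to `μ`.
-/

open Filter Topology

namespace WeightedIFS

/-! ### Bounded distortion -/

section Cone

variable {Y : Type*} {D : Y → Y → ℝ}

/-- A symmetric gauge with values in `[0, 1]`. No triangle inequality is required, so that the
powers `d ^ α` of a metric are covered for every `α > 0`. -/
structure IsUnitGauge (D : Y → Y → ℝ) : Prop where
  nonneg : ∀ x z, 0 ≤ D x z
  le_one : ∀ x z, D x z ≤ 1
  symm : ∀ x z, D x z = D z x

theorem IsUnitGauge.comp (hD : IsUnitGauge D) {Z : Type*} (f : Z → Y) :
    IsUnitGauge fun x z => D (f x) (f z) :=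
  ⟨fun _ _ => hD.nonneg _ _, fun _ _ => hD.le_one _ _, fun _ _ => hD.symm _ _⟩

theorem IsUnitGauge.rpow (hD : IsUnitGauge D) {α : ℝ} (hα : 0 ≤ α) :
    IsUnitGauge fun x z => D x z ^ α :=
  ⟨fun x z => Real.rpow_nonneg (hD.nonneg x z) α,
    fun x z => Real.rpow_le_one (hD.nonneg x z) (hD.le_one x z) hα,
    fun x z => by rw [hD.symm]⟩

variable [TopologicalSpace Y] {A A' : ℝ}

/-- The cone of nonnegative continuous functions whose logarithm is `A`-Lipschitz for the gauge
`D`. -/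
def distortionCone (D : Y → Y → ℝ) (A : ℝ) : Set C(Y, ℝ) :=
  {f | (∀ y, 0 ≤ f y) ∧ ∀ x z, f x ≤ Real.exp (A * D x z) * f z}

theorem smul_mem_distortionCone {f : C(Y, ℝ)} (hf : f ∈ distortionCone D A) {t : ℝ} (ht : 0 ≤ t) :
    t • f ∈ distortionCone D A := by
  refine ⟨fun y => mul_nonneg ht (hf.1 y), fun x z => ?_⟩
  simp only [ContinuousMap.smul_apply, smul_eq_mul, mul_left_comm _ t]
  exact mul_le_mul_of_nonneg_left (hf.2 x z) ht

theorem IsUnitGauge.distortionCone_mono (hD : IsUnitGauge D) (h : A' ≤ A) :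
    distortionCone D A' ⊆ distortionCone D A := fun f hf => ⟨hf.1, fun x z => by
  have hexp : Real.exp (A' * D x z) ≤ Real.exp (A * D x z) :=
    Real.exp_le_exp.2 (mul_le_mul_of_nonneg_right h (hD.nonneg x z))
  exact (hf.2 x z).trans (mul_le_mul_of_nonneg_right hexp (hf.1 z))⟩

theorem IsUnitGauge.one_mem_distortionCone (hD : IsUnitGauge D) (hA : 0 ≤ A) :
    1 ∈ distortionCone D A :=
  ⟨fun _ => zero_le_one, fun x z => by
    simpa using mul_nonneg hA (hD.nonneg x z)⟩

theorem IsUnitGauge.le_exp_mul (hD : IsUnitGauge D) (hA : 0 ≤ A) {f : C(Y, ℝ)}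
    (hf : f ∈ distortionCone D A) (x z : Y) : f x ≤ Real.exp A * f z :=
  (hf.2 x z).trans <| mul_le_mul_of_nonneg_right
    (Real.exp_le_exp.2 (mul_le_of_le_one_right hA (hD.le_one x z))) (hf.1 z)

theorem mul_one_sub_exp_neg_le {η : ℝ} (h0 : 0 ≤ η) (h1 : η ≤ 1) (s : ℝ) :
    η * (1 - Real.exp (-s)) ≤ 1 - Real.exp (-(η * s)) := by
  have h := convexOn_exp.2 (Set.mem_univ (-s)) (Set.mem_univ 0) h0 (sub_nonneg.2 h1)
    (add_sub_cancel η 1)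
  simp only [smul_eq_mul, mul_zero, add_zero, Real.exp_zero, mul_one, mul_neg] at h
  linarith

theorem IsUnitGauge.sub_mem_distortionCone (hD : IsUnitGauge D) (hA : 0 ≤ A + A') {η : ℝ}
    (h0 : 0 ≤ η) (h1 : η ≤ 1) (hη : η * (A + A') = A - A') {u w : C(Y, ℝ)}
    (hu : u ∈ distortionCone D A') (hw : w ∈ distortionCone D A') (hwu : ∀ y, w y ≤ η * u y) :
    u - w ∈ distortionCone D A := by
  refine ⟨fun y => sub_nonneg.2 ((hwu y).trans (mul_le_of_le_one_left (hu.1 y) h1)), fun x z => ?_⟩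
  simp only [ContinuousMap.sub_apply]
  set t := D x z with ht
  have hwx : Real.exp (-(A' * t)) * w z ≤ w x := by
    have hwz := mul_le_mul_of_nonneg_left (hw.2 z x) (Real.exp_pos (-(A' * t))).le
    rwa [hD.symm z x, ← ht, ← mul_assoc, ← Real.exp_add, neg_add_cancel, Real.exp_zero,
      one_mul] at hwz
  have hexp : η * (Real.exp (A * t) - Real.exp (-(A' * t))) ≤
      Real.exp (A * t) - Real.exp (A' * t) := by
    have h := mul_le_mul_of_nonneg_left (mul_one_sub_exp_neg_le h0 h1 ((A + A') * t))
      (Real.exp_pos (A * t)).le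
    rw [← mul_assoc η, hη, mul_left_comm, mul_one_sub, mul_one_sub, ← Real.exp_add,
      ← Real.exp_add] at h
    convert h using 3 <;> congr 1 <;> ring
  have hgap : 0 ≤ Real.exp (A * t) - Real.exp (-(A' * t)) := by
    have := mul_nonneg hA (hD.nonneg x z)
    exact sub_nonneg.2 (Real.exp_le_exp.2 (by linarith))
  have hmain : (Real.exp (A * t) - Real.exp (-(A' * t))) * w z ≤
      (Real.exp (A * t) - Real.exp (A' * t)) * u z :=
    calc (Real.exp (A * t) - Real.exp (-(A' * t))) * w z
        ≤ (Real.exp (A * t) - Real.exp (-(A' * t))) * (η * u z) :=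
          mul_le_mul_of_nonneg_left (hwu z) hgap
      _ = η * (Real.exp (A * t) - Real.exp (-(A' * t))) * u z := by ring
      _ ≤ _ := mul_le_mul_of_nonneg_right hexp (hu.1 z)
  linarith [hu.2 x z]

end Cone

section ContractsDistortion

variable {Y ι : Type*} [TopologicalSpace Y] [CompactSpace Y] [Fintype ι]
variable {R : WeightedIFS Y ι} {D : Y → Y → ℝ} {A : ℝ}

theorem transfer_nonneg {f : C(Y, ℝ)} (hf : ∀ y, 0 ≤ f y) (y : Y) : 0 ≤ R.transfer ℝ f y := by
  rw [transfer_apply]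
  exact Finset.sum_nonneg fun i _ => mul_nonneg (R.weight_pos i y).le (hf _)

theorem transfer_pos [Nonempty ι] {f : C(Y, ℝ)} (hf : ∀ y, 0 < f y) (y : Y) :
    0 < R.transfer ℝ f y := by
  rw [transfer_apply]
  exact Finset.sum_pos (fun i _ => mul_pos (R.weight_pos i y) (hf _)) Finset.univ_nonempty

theorem transfer_pow_succ_apply {𝕜 : Type*} [RCLike 𝕜] (n : ℕ) (f : C(Y, 𝕜)) :
    (R.transfer 𝕜 ^ (n + 1)) f = R.transfer 𝕜 ((R.transfer 𝕜 ^ n) f) := by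
  rw [pow_succ', mul_apply_eq_comp]

theorem transfer_pow_pos [Nonempty ι] {f : C(Y, ℝ)} (hf : ∀ y, 0 < f y) (n : ℕ) :
    ∀ y, 0 < (R.transfer ℝ ^ n) f y := by
  induction n with
  | zero => exact hf
  | succ n ih =>
    rw [transfer_pow_succ_apply]
    exact transfer_pos ih

theorem norm_transfer_pow_apply_le {𝕜 : Type*} [RCLike 𝕜] {f : C(Y, 𝕜)} {g : C(Y, ℝ)}
    (hfg : ∀ y, ‖f y‖ ≤ g y) (n : ℕ) (y : Y) :
    ‖(R.transfer 𝕜 ^ n) f y‖ ≤ (R.transfer ℝ ^ n) g y := by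
  induction n generalizing y with
  | zero => exact hfg y
  | succ n ih =>
    rw [transfer_pow_succ_apply, transfer_pow_succ_apply, transfer_apply, transfer_apply]
    refine norm_sum_le_of_le _ fun i _ => ?_
    rw [norm_mul, RCLike.norm_ofReal, abs_of_pos (R.weight_pos i y)]
    exact mul_le_mul_of_nonneg_left (ih _) (R.weight_pos i y).le

theorem abs_transfer_pow_transfer_le {f : C(Y, ℝ)} {δ : ℝ} (hδ : 0 ≤ δ) {n : ℕ}
    (hf : ∀ x, |(R.transfer ℝ ^ n) f x| ≤ δ * (R.transfer ℝ ^ n) 1 x) (y : Y) :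
    |(R.transfer ℝ ^ n) (R.transfer ℝ f) y| ≤
      δ * ‖R.transfer ℝ 1‖ * (R.transfer ℝ ^ n) 1 y := by
  have hcomm (g : C(Y, ℝ)) :
      (R.transfer ℝ ^ n) (R.transfer ℝ g) = (R.transfer ℝ ^ 1) ((R.transfer ℝ ^ n) g) := by
    rw [← mul_apply_eq_comp, ← mul_apply_eq_comp, pow_one, pow_mul_comm']
  have hone : (R.transfer ℝ ^ n) (R.transfer ℝ 1) y ≤
      ‖R.transfer ℝ 1‖ * (R.transfer ℝ ^ n) 1 y := by
    have h := norm_transfer_pow_apply_le (R := R) (f := R.transfer ℝ 1)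
      (g := ‖R.transfer ℝ 1‖ • 1) (fun x => by simpa using (R.transfer ℝ 1).norm_coe_le_norm x) n y
    rw [map_smul] at h
    exact (le_abs_self _).trans h
  calc |(R.transfer ℝ ^ n) (R.transfer ℝ f) y|
    _ ≤ (R.transfer ℝ ^ 1) (δ • (R.transfer ℝ ^ n) 1) y := by
        rw [hcomm]
        exact norm_transfer_pow_apply_le (𝕜 := ℝ) (g := δ • (R.transfer ℝ ^ n) 1) hf 1 y
    _ = δ * (R.transfer ℝ ^ n) (R.transfer ℝ 1) y := by
        rw [map_smul, ← hcomm]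
        rfl
    _ ≤ δ * ‖R.transfer ℝ 1‖ * (R.transfer ℝ ^ n) 1 y := by
        rw [mul_assoc]
        exact mul_le_mul_of_nonneg_left hone hδ

/-- The transfer operator maps the distortion cone of exponent `A` into the smaller cone of exponent
`A - 1`; the gap `1` is a normalization. -/
structure ContractsDistortion (R : WeightedIFS Y ι) (D : Y → Y → ℝ) (A : ℝ) : Prop
    extends IsUnitGauge D where
  one_le : 1 ≤ A
  transfer_mem : ∀ f ∈ distortionCone D A, R.transfer ℝ f ∈ distortionCone D (A - 1)

theorem contractsDistortion_of_abs_log_weight_sub_le (hD : IsUnitGauge D) {κ C : ℝ} (hκ0 : 0 ≤ κ)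
    (hκ : κ < 1) (hC : 0 ≤ C) (hmap : ∀ i x z, D (R.map i x) (R.map i z) ≤ κ * D x z)
    (hw : ∀ i x z, |Real.log (R.weight i x) - Real.log (R.weight i z)| ≤ C * D x z) :
    R.ContractsDistortion D ((C + 1) / (1 - κ)) where
  toIsUnitGauge := hD
  one_le := by
    rw [one_le_div (sub_pos.2 hκ)]
    linarith
  transfer_mem f hf := by
    set A := (C + 1) / (1 - κ)
    have hA0 : 0 ≤ A := div_nonneg (by linarith) (by linarith)
    have hA1 : A - 1 = C + A * κ := by
      have : A * (1 - κ) = C + 1 := div_mul_cancel₀ _ (sub_pos.2 hκ).ne'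
      linarith
    refine ⟨transfer_nonneg hf.1, fun x z => ?_⟩
    rw [transfer_apply, transfer_apply, Finset.mul_sum]
    refine Finset.sum_le_sum fun i _ => ?_
    have hweight : R.weight i x ≤ Real.exp (C * D x z) * R.weight i z := by
      rw [← Real.log_le_log_iff (R.weight_pos i x) (mul_pos (Real.exp_pos _) (R.weight_pos i z)),
        Real.log_mul (Real.exp_pos _).ne' (R.weight_pos i z).ne', Real.log_exp]
      linarith [le_abs_self (Real.log (R.weight i x) - Real.log (R.weight i z)), hw i x z]
    have hf' : f (R.map i x) ≤ Real.exp (A * κ * D x z) * f (R.map i z) := by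
      refine (hf.2 _ _).trans (mul_le_mul_of_nonneg_right (Real.exp_le_exp.2 ?_) (hf.1 _))
      rw [mul_assoc]
      exact mul_le_mul_of_nonneg_left (hmap i x z) hA0
    calc R.weight i x * f (R.map i x)
        ≤ Real.exp (C * D x z) * R.weight i z * (Real.exp (A * κ * D x z) * f (R.map i z)) :=
          mul_le_mul hweight hf' (hf.1 _) (mul_pos (Real.exp_pos _) (R.weight_pos i z)).le
      _ = Real.exp ((A - 1) * D x z) * (R.weight i z * f (R.map i z)) := by
          rw [hA1, add_mul, Real.exp_add]
          ring

/-- The factor by which one application of the transfer operator narrows the brackets of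
`IsConeBracket`. -/
noncomputable def bracketRate (A : ℝ) : ℝ :=
  1 - Real.exp (-(2 * (A - 1))) / (2 * A - 1)

theorem bracketRate_nonneg (hA : 1 ≤ A) : 0 ≤ bracketRate A := by
  rw [bracketRate, sub_nonneg, div_le_one (by linarith)]
  exact (Real.exp_le_one_iff.2 (by linarith)).trans (by linarith)

theorem bracketRate_lt_one (hA : 1 ≤ A) : bracketRate A < 1 :=
  sub_lt_self 1 (div_pos (Real.exp_pos _) (by linarith))

/-- `f` lies between `m • v` and `M • v` for the partial order defined by the distortion cone. The
best constants `m`, `M` compute the Hilbert projective distance of `f` and `v`. -/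
def IsConeBracket (D : Y → Y → ℝ) (A : ℝ) (v f : C(Y, ℝ)) (m M : ℝ) : Prop :=
  f - m • v ∈ distortionCone D A ∧ M • v - f ∈ distortionCone D A

namespace ContractsDistortion

theorem transfer_mem_self (hR : R.ContractsDistortion D A) {f : C(Y, ℝ)}
    (hf : f ∈ distortionCone D A) : R.transfer ℝ f ∈ distortionCone D A :=
  hR.distortionCone_mono (sub_le_self A zero_le_one) (hR.transfer_mem f hf)

theorem transfer_pow_one_mem (hR : R.ContractsDistortion D A) (n : ℕ) :
    (R.transfer ℝ ^ n) 1 ∈ distortionCone D A := by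
  induction n with
  | zero => exact hR.one_mem_distortionCone (zero_le_one.trans hR.one_le)
  | succ n ih =>
    rw [transfer_pow_succ_apply]
    exact hR.transfer_mem_self ih

theorem sub_smul_mem (hR : R.ContractsDistortion D A) {u v : C(Y, ℝ)}
    (hu : u ∈ distortionCone D (A - 1)) (hv : v ∈ distortionCone D (A - 1)) {a : ℝ} (ha : 0 ≤ a)
    {x₀ : Y} (hx₀ : a * v x₀ ≤ u x₀) : u - ((1 - bracketRate A) * a) • v ∈ distortionCone D A := by
  have hA := hR.one_le
  have hη : 0 < 2 * A - 1 := by linarith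
  have hrate : 0 ≤ (1 - bracketRate A) * a :=
    mul_nonneg (sub_nonneg.2 (bracketRate_lt_one hA).le) ha
  have hav (y : Y) : a * v y ≤ Real.exp (2 * (A - 1)) * u y :=
    calc a * v y ≤ a * (Real.exp (A - 1) * v x₀) :=
          mul_le_mul_of_nonneg_left (hR.le_exp_mul (sub_nonneg.2 hA) hv y x₀) ha
      _ = Real.exp (A - 1) * (a * v x₀) := by ring
      _ ≤ Real.exp (A - 1) * (Real.exp (A - 1) * u y) := by
          gcongr Real.exp (A - 1) * ?_
          exact hx₀.trans (hR.le_exp_mul (sub_nonneg.2 hA) hu x₀ y)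
      _ = Real.exp (2 * (A - 1)) * u y := by rw [← mul_assoc, ← Real.exp_add, two_mul]
  refine hR.sub_mem_distortionCone (by linarith) (inv_nonneg.2 hη.le)
    (inv_le_one_of_one_le₀ (by linarith)) ?_ hu (smul_mem_distortionCone hv hrate) fun y => ?_
  · rw [show A + (A - 1) = 2 * A - 1 by ring, inv_mul_cancel₀ hη.ne', sub_sub_cancel]
  · calc (1 - bracketRate A) * a * v y
        = (2 * A - 1)⁻¹ * (Real.exp (-(2 * (A - 1))) * (a * v y)) := by
          rw [bracketRate]
          ring
      _ ≤ (2 * A - 1)⁻¹ * (Real.exp (-(2 * (A - 1))) * (Real.exp (2 * (A - 1)) * u y)) := by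
          gcongr (2 * A - 1)⁻¹ * (Real.exp (-(2 * (A - 1))) * ?_)
          exact hav y
      _ = (2 * A - 1)⁻¹ * u y := by
          rw [← mul_assoc (Real.exp _), ← Real.exp_add, neg_add_cancel, Real.exp_zero, one_mul]

variable [Nonempty Y] [Nonempty ι]

theorem exists_isConeBracket_transfer (hR : R.ContractsDistortion D A) {f v : C(Y, ℝ)} {m M : ℝ}
    (hv : v ∈ distortionCone D A) (hv0 : ∀ y, 0 < v y) (hf : IsConeBracket D A v f m M) :
    ∃ m' M', M' - m' = bracketRate A * (M - m) ∧
      IsConeBracket D A (R.transfer ℝ v) (R.transfer ℝ f) m' M' := by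
  inhabit Y
  set x₀ : Y := default
  have hv' := hR.transfer_mem v hv
  have hv0' : 0 < R.transfer ℝ v x₀ := transfer_pos hv0 x₀
  have hlow := hR.transfer_mem _ hf.1
  have hupp := hR.transfer_mem _ hf.2
  rw [map_sub, map_smul] at hlow hupp
  set a := R.transfer ℝ f x₀ / R.transfer ℝ v x₀
  have hax₀ : a * R.transfer ℝ v x₀ = R.transfer ℝ f x₀ := div_mul_cancel₀ _ hv0'.ne'
  have hma : m ≤ a := (le_div_iff₀ hv0').2 (sub_nonneg.1 (hlow.1 x₀))
  have haM : a ≤ M := (div_le_iff₀ hv0').2 (sub_nonneg.1 (hupp.1 x₀))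
  refine ⟨m + (1 - bracketRate A) * (a - m), M - (1 - bracketRate A) * (M - a), by ring, ?_, ?_⟩
  · rw [add_smul, ← sub_sub]
    refine hR.sub_smul_mem hlow hv' (sub_nonneg.2 hma) (x₀ := x₀) ?_
    simp [sub_mul, hax₀]
  · rw [sub_smul, sub_right_comm]
    refine hR.sub_smul_mem hupp hv' (sub_nonneg.2 haM) (x₀ := x₀) ?_
    simp [sub_mul, hax₀]

theorem exists_isConeBracket_transfer_pow (hR : R.ContractsDistortion D A) {f : C(Y, ℝ)}
    {m M : ℝ} (hf : IsConeBracket D A 1 f m M) (n : ℕ) :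
    ∃ m' M', M' - m' = bracketRate A ^ n * (M - m) ∧
      IsConeBracket D A ((R.transfer ℝ ^ n) 1) ((R.transfer ℝ ^ n) f) m' M' := by
  induction n with
  | zero => exact ⟨m, M, by simp, hf⟩
  | succ n ih =>
    obtain ⟨m', M', hwidth, hbracket⟩ := ih
    obtain ⟨m'', M'', hwidth', hbracket'⟩ := hR.exists_isConeBracket_transfer
      (hR.transfer_pow_one_mem n) (transfer_pow_pos (fun _ => one_pos) n) hbracket
    refine ⟨m'', M'', by rw [hwidth', hwidth, pow_succ']; ring, ?_⟩
    rwa [transfer_pow_succ_apply, transfer_pow_succ_apply]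

end ContractsDistortion

end ContractsDistortion

section GaugeLipschitz

variable {Y : Type*} [TopologicalSpace Y] [CompactSpace Y] {D : Y → Y → ℝ} {A : ℝ}

/-- The algebra of continuous functions that are Lipschitz for the gauge `D`. -/
def gaugeLipschitz (D : Y → Y → ℝ) : Subalgebra ℝ C(Y, ℝ) where
  carrier := {g | ∃ ℓ, ∀ x z, |g x - g z| ≤ ℓ * D x z}
  mul_mem' := by
    rintro f g ⟨a, ha⟩ ⟨b, hb⟩
    refine ⟨‖f‖ * b + ‖g‖ * a, fun x z => ?_⟩
    calc |f x * g x - f z * g z| = |f x * (g x - g z) + g z * (f x - f z)| := by ring_nf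
      _ ≤ |f x| * |g x - g z| + |g z| * |f x - f z| := by
          rw [← abs_mul, ← abs_mul]
          exact abs_add_le _ _
      _ ≤ ‖f‖ * (b * D x z) + ‖g‖ * (a * D x z) := by
          gcongr
          exacts [f.norm_coe_le_norm x, hb x z, g.norm_coe_le_norm z, ha x z]
      _ = (‖f‖ * b + ‖g‖ * a) * D x z := by ring
  add_mem' := by
    rintro f g ⟨a, ha⟩ ⟨b, hb⟩
    refine ⟨a + b, fun x z => ?_⟩
    calc |f x + g x - (f z + g z)| = |(f x - f z) + (g x - g z)| := by ring_nf
      _ ≤ a * D x z + b * D x z := (abs_add_le _ _).trans (add_le_add (ha x z) (hb x z))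
      _ = (a + b) * D x z := by ring
  algebraMap_mem' a := ⟨0, fun x z => by simp⟩

theorem dense_gaugeLipschitz (h : (gaugeLipschitz D).SeparatesPoints) :
    Dense (gaugeLipschitz D : Set C(Y, ℝ)) := by
  rw [dense_iff_closure_eq, ← Subalgebra.topologicalClosure_coe,
    ContinuousMap.subalgebra_topologicalClosure_eq_top_of_separatesPoints _ h, Algebra.coe_top]

theorem IsUnitGauge.distortionCone_subset_gaugeLipschitz (hD : IsUnitGauge D) (hA : 0 ≤ A) :
    distortionCone D A ⊆ gaugeLipschitz D := by
  intro f hf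
  have hsub (x z : Y) : f x - f z ≤ A * Real.exp A * ‖f‖ * D x z := by
    have hs : 0 ≤ A * D x z := mul_nonneg hA (hD.nonneg x z)
    have hexp : Real.exp (A * D x z) - 1 ≤ A * D x z * Real.exp (A * D x z) := by
      have h := mul_le_mul_of_nonneg_right (Real.one_sub_le_exp_neg (A * D x z))
        (Real.exp_pos (A * D x z)).le
      rw [← Real.exp_add, neg_add_cancel, Real.exp_zero] at h
      linarith
    calc f x - f z ≤ (Real.exp (A * D x z) - 1) * f z := by linarith [hf.2 x z]
      _ ≤ A * D x z * Real.exp A * ‖f‖ := by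
          gcongr
          · exact hf.1 z
          · refine hexp.trans (mul_le_mul_of_nonneg_left (Real.exp_le_exp.2 ?_) hs)
            exact mul_le_of_le_one_right hA (hD.le_one x z)
          · exact f.apply_le_norm z
      _ = A * Real.exp A * ‖f‖ * D x z := by ring
  exact ⟨A * Real.exp A * ‖f‖, fun x z => abs_sub_le_iff.2 ⟨hsub x z, hD.symm z x ▸ hsub z x⟩⟩

theorem IsUnitGauge.exists_smul_one_sub_mem_distortionCone (hD : IsUnitGauge D) (hA : 0 < A)
    {g : C(Y, ℝ)} (hg : g ∈ gaugeLipschitz D) : ∃ M : ℝ, M • 1 - g ∈ distortionCone D A := by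
  obtain ⟨ℓ, hℓ⟩ := hg
  have hlarge (y : Y) : |ℓ| / A ≤ ‖g‖ + |ℓ| / A - g y := by linarith [g.apply_le_norm y]
  have hpos (y : Y) : 0 ≤ ‖g‖ + |ℓ| / A - g y := (by positivity : 0 ≤ |ℓ| / A).trans (hlarge y)
  refine ⟨‖g‖ + |ℓ| / A, fun y => by simpa using hpos y, fun x z => ?_⟩
  simp only [ContinuousMap.sub_apply, ContinuousMap.smul_apply, ContinuousMap.one_apply,
    smul_eq_mul, mul_one]
  set M := ‖g‖ + |ℓ| / A
  have hLip : g z - g x ≤ A * (M - g z) * D x z :=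
    calc g z - g x ≤ |g x - g z| := by
          rw [abs_sub_comm]
          exact le_abs_self _
      _ ≤ |ℓ| * D x z := (hℓ x z).trans (mul_le_mul_of_nonneg_right (le_abs_self ℓ) (hD.nonneg x z))
      _ ≤ A * (M - g z) * D x z :=
          mul_le_mul_of_nonneg_right ((div_le_iff₀' hA).1 (hlarge z)) (hD.nonneg x z)
  calc M - g x ≤ (A * D x z + 1) * (M - g z) := by linarith
    _ ≤ Real.exp (A * D x z) * (M - g z) :=
        mul_le_mul_of_nonneg_right (Real.add_one_le_exp _) (hpos z)

theorem IsUnitGauge.exists_isConeBracket_one (hD : IsUnitGauge D) (hA : 0 < A) {g : C(Y, ℝ)}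
    (hg : g ∈ gaugeLipschitz D) : ∃ m M, IsConeBracket D A 1 g m M := by
  obtain ⟨M, hM⟩ := hD.exists_smul_one_sub_mem_distortionCone hA hg
  obtain ⟨m, hm⟩ := hD.exists_smul_one_sub_mem_distortionCone hA (neg_mem hg)
  exact ⟨-m, M, by rwa [neg_smul, sub_neg_eq_add, add_comm, ← sub_neg_eq_add], hM⟩

end GaugeLipschitz

/-! ### Ratio limits of the iterates -/

section DualTransfer

variable {Y ι : Type*} [TopologicalSpace Y] [MeasurableSpace Y] [BorelSpace Y] [Fintype ι]

/-- The dual operator `B_R^*` on measures. -/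
noncomputable def dualTransfer (R : WeightedIFS Y ι) (μ : Measure Y) : Measure Y :=
  ∑ i, (μ.withDensity fun y => ENNReal.ofReal (R.weight i y)).map (R.map i)

variable {R : WeightedIFS Y ι}

theorem lintegral_dualTransfer (μ : Measure Y) {f : Y → ℝ≥0∞} (hf : Measurable f) :
    ∫⁻ y, f y ∂(R.dualTransfer μ) =
      ∫⁻ y, ∑ i, ENNReal.ofReal (R.weight i y) * f (R.map i y) ∂μ := by
  have hfi (i : ι) : Measurable fun y => f (R.map i y) := hf.comp (R.map i).continuous.measurable
  have hw (i : ι) : Measurable fun y => ENNReal.ofReal (R.weight i y) := by fun_prop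
  have hprod (i : ι) : Measurable fun y => ENNReal.ofReal (R.weight i y) * f (R.map i y) :=
    (hw i).mul (hfi i)
  rw [dualTransfer, lintegral_finsetSum_measure, lintegral_finsetSum _ fun i _ => hprod i]
  refine Finset.sum_congr rfl fun i _ => ?_
  rw [lintegral_map hf (R.map i).continuous.measurable,
    lintegral_withDensity_eq_lintegral_mul _ (hw i) (hfi i)]
  simp only [Pi.mul_apply]

section Compact

variable [CompactSpace Y]

theorem integrable_continuousMap (μ : Measure Y) [IsFiniteMeasure μ] (f : C(Y, ℝ)) :
    Integrable f μ :=
  f.continuous.integrable_of_hasCompactSupport (HasCompactSupport.of_compactSpace f)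

instance isFiniteMeasure_withDensity_weight (μ : Measure Y) [IsFiniteMeasure μ] (i : ι) :
    IsFiniteMeasure (μ.withDensity fun y => ENNReal.ofReal (R.weight i y)) :=
  isFiniteMeasure_withDensity_ofReal (integrable_continuousMap μ (R.weight i)).2

instance isFiniteMeasure_dualTransfer (μ : Measure Y) [IsFiniteMeasure μ] :
    IsFiniteMeasure (R.dualTransfer μ) := by
  rw [dualTransfer]
  infer_instance

theorem integral_dualTransfer (μ : Measure Y) [IsFiniteMeasure μ] (f : C(Y, ℝ)) :
    ∫ y, f y ∂(R.dualTransfer μ) = ∫ y, R.transfer ℝ f y ∂μ := by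
  have hprod (i : ι) : Integrable (fun y => R.weight i y * f (R.map i y)) μ :=
    integrable_continuousMap μ (R.weight i * f.comp (R.map i))
  simp only [transfer_apply, RCLike.ofReal_real_eq_id, id_eq]
  rw [dualTransfer, integral_finsetSum_measure fun i _ => integrable_continuousMap _ f,
    integral_finsetSum _ fun i _ => hprod i]
  refine Finset.sum_congr rfl fun i _ => ?_
  rw [integral_map (R.map i).continuous.measurable.aemeasurable
    f.continuous.aestronglyMeasurable, integral_withDensity_eq_integral_toReal_smul (by fun_prop)
    (Eventually.of_forall fun _ => ENNReal.ofReal_lt_top)]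
  simp [ENNReal.toReal_ofReal (R.weight_pos i _).le]

theorem exists_probabilityMeasure_integral_mul_transfer_pow_one [Nonempty Y] (R : WeightedIFS Y ι)
    (n : ℕ) (x : Y) : ∃ ν : ProbabilityMeasure Y, ∀ g : C(Y, ℝ),
      (∫ y, g y ∂(ν : Measure Y)) * (R.transfer ℝ ^ n) 1 x = (R.transfer ℝ ^ n) g x := by
  induction n with
  | zero => exact ⟨⟨Measure.dirac x, inferInstance⟩, fun g => by
    simp [integral_dirac' _ _ g.continuous.stronglyMeasurable]⟩
  | succ n ih =>
    obtain ⟨ν, hν⟩ := ih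
    let ν' : FiniteMeasure Y := ⟨R.dualTransfer ν, inferInstance⟩
    refine ⟨ν'.normalize, fun g => ?_⟩
    have hmass (f : C(Y, ℝ)) : ∫ y, R.transfer ℝ f y ∂(ν : Measure Y) =
        ν'.mass * ∫ y, f y ∂(ν'.normalize : Measure Y) := by
      have h : R.dualTransfer ν = ν'.mass • (ν'.normalize : Measure Y) :=
        congrArg FiniteMeasure.toMeasure ν'.self_eq_mass_smul_normalize
      rw [← integral_dualTransfer, h, integral_smul_nnreal_measure]
      rfl
    simp only [pow_succ, mul_apply_eq_comp]
    rw [← hν (R.transfer ℝ 1), ← hν (R.transfer ℝ g), hmass, hmass]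
    simp only [ContinuousMap.one_apply, integral_const, probReal_univ, smul_eq_mul, mul_one]
    ring

end Compact

end DualTransfer

section RatioLimit

variable {Y ι : Type*} [TopologicalSpace Y] [CompactSpace Y] [MeasurableSpace Y] [Fintype ι]
variable {R : WeightedIFS Y ι} {D : Y → Y → ℝ} {A : ℝ}

/-- The ratios `B_R ^ n g / B_R ^ n 1` converge uniformly to the constant `∫ g dμ`. -/
def HasRatioLimit (R : WeightedIFS Y ι) (μ : ProbabilityMeasure Y) : Prop :=
  ∀ g : C(Y, ℝ), ∀ ε > 0, ∀ᶠ n in atTop, ∀ y,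
    |(R.transfer ℝ ^ n) g y - (∫ x, g x ∂(μ : Measure Y)) * (R.transfer ℝ ^ n) 1 y| ≤
      ε * (R.transfer ℝ ^ n) 1 y

/-- For all `n` and `g`, the integral of `g` is at least the minimum of `B_R ^ n g / B_R ^ n 1` (and
hence, replacing `g` by `-g`, at most its maximum). -/
def IsRatioMean (R : WeightedIFS Y ι) (μ : ProbabilityMeasure Y) : Prop :=
  ∀ (n : ℕ) (g : C(Y, ℝ)) (m : ℝ),
    (∀ y, m * (R.transfer ℝ ^ n) 1 y ≤ (R.transfer ℝ ^ n) g y) → m ≤ ∫ y, g y ∂(μ : Measure Y)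

variable [Nonempty Y] [Nonempty ι]

theorem ContractsDistortion.abs_sub_integral_mul_le (hR : R.ContractsDistortion D A)
    {μ : ProbabilityMeasure Y} (hμ : R.IsRatioMean μ)
    {g : C(Y, ℝ)} (hg : g ∈ gaugeLipschitz D) : ∃ E, ∀ n y,
      |(R.transfer ℝ ^ n) g y - (∫ x, g x ∂(μ : Measure Y)) * (R.transfer ℝ ^ n) 1 y| ≤
        E * bracketRate A ^ n * (R.transfer ℝ ^ n) 1 y := by
  obtain ⟨m, M, hmM⟩ := hR.exists_isConeBracket_one (zero_lt_one.trans_le hR.one_le) hg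
  refine ⟨M - m, fun n y => ?_⟩
  obtain ⟨m', M', hwidth, hlow, hupp⟩ := hR.exists_isConeBracket_transfer_pow hmM n
  have hm' (y : Y) : m' * (R.transfer ℝ ^ n) 1 y ≤ (R.transfer ℝ ^ n) g y := sub_nonneg.1 (hlow.1 y)
  have hM' (y : Y) : (R.transfer ℝ ^ n) g y ≤ M' * (R.transfer ℝ ^ n) 1 y := sub_nonneg.1 (hupp.1 y)
  have hmint : m' ≤ ∫ x, g x ∂(μ : Measure Y) := hμ n g m' hm'
  have hintM : ∫ x, g x ∂(μ : Measure Y) ≤ M' := by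
    have h := hμ n (-g) (-M') fun y => by simpa using hM' y
    simp only [ContinuousMap.neg_apply, integral_neg] at h
    exact neg_le_neg_iff.1 h
  have hpos : 0 < (R.transfer ℝ ^ n) 1 y := transfer_pow_pos (fun _ => one_pos) n y
  rw [mul_comm (M - m), ← hwidth, abs_le]
  constructor <;> nlinarith [hm' y, hM' y]

variable [BorelSpace Y]

theorem exists_isRatioMean [T2Space Y] [HasOuterApproxClosed Y] (R : WeightedIFS Y ι) :
    ∃ μ, R.IsRatioMean μ := by
  -- These sets are weak-* compact, and they decrease with `n` because the operator is positive.
  let S (n : ℕ) : Set (ProbabilityMeasure Y) := {μ | ∀ (g : C(Y, ℝ)) (m : ℝ),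
    (∀ y, m * (R.transfer ℝ ^ n) 1 y ≤ (R.transfer ℝ ^ n) g y) → m ≤ ∫ y, g y ∂(μ : Measure Y)}
  have hanti (n : ℕ) : S (n + 1) ⊆ S n := fun μ hμ g m hm => hμ g m fun y => by
    have hnonneg (y : Y) : 0 ≤ ((R.transfer ℝ ^ n) g - m • (R.transfer ℝ ^ n) 1) y :=
      sub_nonneg.2 (hm y)
    rw [transfer_pow_succ_apply, transfer_pow_succ_apply]
    simpa using transfer_nonneg (R := R) hnonneg y
  have hclosed (n : ℕ) : IsClosed (S n) := by
    simp only [S, Set.ofPred_forall]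
    exact isClosed_iInter fun g => isClosed_iInter fun m => isClosed_iInter fun _ =>
      isClosed_le continuous_const (ProbabilityMeasure.continuous_integral_boundedContinuousFunction
        (BoundedContinuousFunction.mkOfCompact g))
  have hne (n : ℕ) : (S n).Nonempty := by
    let x₀ : Y := Classical.arbitrary Y
    obtain ⟨ν, hν⟩ := exists_probabilityMeasure_integral_mul_transfer_pow_one R n x₀
    refine ⟨ν, fun g m hm => ?_⟩
    have hpos : 0 < (R.transfer ℝ ^ n) 1 x₀ := transfer_pow_pos (fun _ => one_pos) n x₀
    exact le_of_mul_le_mul_right ((hm x₀).trans_eq (hν g).symm) hpos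
  obtain ⟨μ, hμ⟩ := IsCompact.nonempty_iInter_of_sequence_nonempty_isCompact_isClosed S hanti hne
    (hclosed 0).isCompact hclosed
  exact ⟨μ, Set.mem_iInter.1 hμ⟩

theorem ContractsDistortion.hasRatioLimit (hR : R.ContractsDistortion D A)
    (hsep : (gaugeLipschitz D).SeparatesPoints) {μ : ProbabilityMeasure Y}
    (hμ : R.IsRatioMean μ) : R.HasRatioLimit μ := by
  intro g ε hε
  obtain ⟨g', hg', hdist⟩ :=
    (dense_gaugeLipschitz hsep).exists_dist_lt g (by positivity : 0 < ε / 3)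
  rw [dist_eq_norm] at hdist
  obtain ⟨E, hE⟩ := hR.abs_sub_integral_mul_le hμ hg'
  have hgeom : Tendsto (fun n => E * bracketRate A ^ n) atTop (𝓝 0) := by
    simpa using (tendsto_pow_atTop_nhds_zero_of_lt_one (bracketRate_nonneg hR.one_le)
      (bracketRate_lt_one hR.one_le)).const_mul E
  filter_upwards [hgeom.eventually_le_const (by positivity : 0 < ε / 3)] with n hn y
  have hpos : 0 < (R.transfer ℝ ^ n) 1 y := transfer_pow_pos (fun _ => one_pos) n y
  have hint : |∫ x, g' x ∂(μ : Measure Y) - ∫ x, g x ∂(μ : Measure Y)| ≤ ε / 3 := by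
    rw [abs_sub_comm, ← integral_sub (integrable_continuousMap _ g) (integrable_continuousMap _ g')]
    have hbound (x : Y) : ‖g x - g' x‖ ≤ ε / 3 :=
      ((g - g').norm_coe_le_norm x).trans hdist.le
    simpa using norm_integral_le_of_norm_le_const (μ := (μ : Measure Y))
      (Eventually.of_forall hbound)
  have happrox : |(R.transfer ℝ ^ n) g y - (R.transfer ℝ ^ n) g' y| ≤
      ε / 3 * (R.transfer ℝ ^ n) 1 y := by
    have h := norm_transfer_pow_apply_le (R := R) (f := g - g') (g := (ε / 3) • 1)
      (fun x => by simpa using ((g - g').norm_coe_le_norm x).trans hdist.le) n y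
    simpa using h
  calc _ = |((R.transfer ℝ ^ n) g y - (R.transfer ℝ ^ n) g' y) +
        ((R.transfer ℝ ^ n) g' y - (∫ x, g' x ∂(μ : Measure Y)) * (R.transfer ℝ ^ n) 1 y) +
        (∫ x, g' x ∂(μ : Measure Y) - ∫ x, g x ∂(μ : Measure Y)) * (R.transfer ℝ ^ n) 1 y| := by
        ring_nf
    _ ≤ ε / 3 * (R.transfer ℝ ^ n) 1 y + ε / 3 * (R.transfer ℝ ^ n) 1 y +
        ε / 3 * (R.transfer ℝ ^ n) 1 y := by
        refine (abs_add_three _ _ _).trans (add_le_add_three happrox ((hE n y).trans ?_) ?_)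
        · gcongr
        · rw [abs_mul, abs_of_pos hpos]
          gcongr
    _ = ε * (R.transfer ℝ ^ n) 1 y := by ring

end RatioLimit

/-! ### The leading eigenvalue, eigenmeasure and eigenfunction -/

section SpectralRadius

variable {Y ι : Type*} [TopologicalSpace Y] [CompactSpace Y] [Fintype ι] {R : WeightedIFS Y ι}
variable {l : ℝ} {h : C(Y, ℝ)}

theorem transfer_pow_eigenfunction (hh : R.transfer ℝ h = l • h) (n : ℕ) :
    (R.transfer ℝ ^ n) h = l ^ n • h := by
  induction n with
  | zero => simp
  | succ n ih => rw [transfer_pow_succ_apply, ih, map_smul, hh, smul_smul, pow_succ]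

theorem exists_norm_transfer_pow_le (hl : 0 ≤ l) (h0 : ∀ y, 0 < h y) (hh : R.transfer ℝ h = l • h)
    (𝕜 : Type*) [RCLike 𝕜] :
    ∃ K, 0 ≤ K ∧ ∀ n f, ‖(R.transfer 𝕜 ^ n) f‖ ≤ K * l ^ n * ‖f‖ := by
  let hinv : C(Y, ℝ) := ⟨fun y => (h y)⁻¹, h.continuous.inv₀ fun y => (h0 y).ne'⟩
  refine ⟨‖hinv‖ * ‖h‖, by positivity, fun n f => ?_⟩
  refine (ContinuousMap.norm_le _ (by positivity)).2 fun y => ?_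
  have hf (y : Y) : ‖f y‖ ≤ ((‖f‖ * ‖hinv‖) • h) y :=
    calc ‖f y‖ ≤ ‖f‖ * (hinv y * h y) := by
          rw [show hinv y * h y = 1 from inv_mul_cancel₀ (h0 y).ne', mul_one]
          exact f.norm_coe_le_norm y
      _ ≤ ‖f‖ * (‖hinv‖ * h y) := by
          have := (h0 y).le
          gcongr
          exact hinv.apply_le_norm y
      _ = _ := (mul_assoc _ _ _).symm
  calc ‖(R.transfer 𝕜 ^ n) f y‖ ≤ (R.transfer ℝ ^ n) ((‖f‖ * ‖hinv‖) • h) y :=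
        norm_transfer_pow_apply_le hf n y
    _ = ‖f‖ * ‖hinv‖ * (l ^ n * h y) := by rw [map_smul, transfer_pow_eigenfunction hh]; rfl
    _ ≤ ‖f‖ * ‖hinv‖ * (l ^ n * ‖h‖) := by gcongr; exact h.apply_le_norm y
    _ = ‖hinv‖ * ‖h‖ * l ^ n * ‖f‖ := by ring

theorem norm_le_of_mem_spectrum_of_norm_pow_le {𝕜 𝔸 : Type*} [NontriviallyNormedField 𝕜]
    [NormedRing 𝔸] [NormedAlgebra 𝕜 𝔸] [CompleteSpace 𝔸] {a : 𝔸} {K : ℝ} (hl : 0 < l)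
    (h : ∀ n : ℕ, ‖a ^ n‖ ≤ K * l ^ n) {k : 𝕜} (hk : k ∈ spectrum 𝕜 a) : ‖k‖ ≤ l := by
  have hbdd (n : ℕ) : (‖k‖ / l) ^ n ≤ K * ‖(1 : 𝔸)‖ := by
    rw [div_pow, div_le_iff₀ (by positivity), ← norm_pow]
    calc ‖k ^ n‖ ≤ ‖a ^ n‖ * ‖(1 : 𝔸)‖ :=
          spectrum.norm_le_norm_mul_of_mem (spectrum.pow_mem_pow a n hk)
      _ ≤ K * l ^ n * ‖(1 : 𝔸)‖ := mul_le_mul_of_nonneg_right (h n) (norm_nonneg _)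
      _ = K * ‖(1 : 𝔸)‖ * l ^ n := by ring
  by_contra! hlt
  obtain ⟨n, hn⟩ := pow_unbounded_of_one_lt (K * ‖(1 : 𝔸)‖) ((one_lt_div hl).2 hlt)
  exact (hbdd n).not_gt hn

theorem spectralRadius_eq_of_mem_spectrum {𝔸 : Type*} [NormedRing 𝔸] [NormedAlgebra ℂ 𝔸]
    [CompleteSpace 𝔸] {a : 𝔸} {K : ℝ} (hl : 0 < l) (h : ∀ n : ℕ, ‖a ^ n‖ ≤ K * l ^ n)
    (hmem : (l : ℂ) ∈ spectrum ℂ a) : spectralRadius ℂ a = ENNReal.ofReal l := by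
  have henorm (k : ℂ) : (‖k‖₊ : ℝ≥0∞) = ENNReal.ofReal ‖k‖ := by
    rw [← enorm_eq_nnnorm, ofReal_norm]
  refine le_antisymm (iSup₂_le fun k hk => ?_) ?_
  · rw [henorm]
    exact ENNReal.ofReal_le_ofReal (norm_le_of_mem_spectrum_of_norm_pow_le hl h hk)
  · have hle := le_iSup₂ (f := fun (k : ℂ) (_ : k ∈ spectrum ℂ a) => (‖k‖₊ : ℝ≥0∞)) _ hmem
    rwa [henorm, Complex.norm_real, Real.norm_of_nonneg hl.le] at hle

theorem coe_mem_spectrum_transfer (h0 : h ≠ 0) (hh : R.transfer ℝ h = l • h) :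
    (l : ℂ) ∈ spectrum ℂ (R.transfer ℂ) := by
  let hc : C(Y, ℂ) := ⟨fun y => (h y : ℂ), by fun_prop⟩
  have heig : R.transfer ℂ hc = (l : ℂ) • hc := by
    ext y
    have h := congrArg (fun t : ℝ => (t : ℂ)) (DFunLike.congr_fun hh y)
    simpa [transfer_apply, hc] using h
  have hc0 : hc ≠ 0 := fun hzero => h0 <| by
    ext y
    exact Complex.ofReal_eq_zero.1 (DFunLike.congr_fun hzero y)
  rw [ContinuousLinearMap.spectrum_eq (f := R.transfer ℂ)]
  exact (Module.End.hasEigenvalue_of_hasEigenvector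
    (Module.End.hasEigenvector_iff.2 ⟨Module.End.mem_eigenspace_iff.2 heig, hc0⟩)).mem_spectrum

theorem rho_eq_of_eigenfunction [Nonempty Y] (hl : 0 < l) (h0 : ∀ y, 0 < h y)
    (hh : R.transfer ℝ h = l • h) : R.rho = l := by
  obtain ⟨K, hK0, hK⟩ := exists_norm_transfer_pow_le hl.le h0 hh ℂ
  have hpow (n : ℕ) : ‖R.transfer ℂ ^ n‖ ≤ K * l ^ n :=
    ContinuousLinearMap.opNorm_le_bound _ (by positivity) (hK n)
  have hne : h ≠ 0 := fun hzero => (h0 (Classical.arbitrary Y)).ne' (by simp [hzero])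
  have hspec : spectralRadius ℂ (R.transfer ℂ) = ENNReal.ofReal l :=
    spectralRadius_eq_of_mem_spectrum (𝔸 := C(Y, ℂ) →L[ℂ] C(Y, ℂ)) hl hpow
      (coe_mem_spectrum_transfer hne hh)
  exact (congrArg ENNReal.toReal hspec).trans (ENNReal.toReal_ofReal hl.le)

end SpectralRadius

section Perron

variable {Y ι : Type*} [TopologicalSpace Y] [CompactSpace Y] [MeasurableSpace Y]
variable [Fintype ι] {R : WeightedIFS Y ι} {D : Y → Y → ℝ} {A l : ℝ} {μ ν : ProbabilityMeasure Y}

/-- `μ` is an eigenmeasure of the dual operator: `B_R^*(μ) = l μ`, tested on continuous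
functions. -/
def IsEigenmeasure (R : WeightedIFS Y ι) (l : ℝ) (μ : ProbabilityMeasure Y) : Prop :=
  ∀ f : C(Y, ℝ), ∫ y, R.transfer ℝ f y ∂(μ : Measure Y) = l * ∫ y, f y ∂(μ : Measure Y)

/-- The iterates `l ^ (-n) B_R ^ n 1`, normalized so as to converge when `l` is the leading
eigenvalue. -/
noncomputable def normalizedIterate (R : WeightedIFS Y ι) (l : ℝ) (n : ℕ) : C(Y, ℝ) :=
  (l ^ n)⁻¹ • (R.transfer ℝ ^ n) 1

theorem IsEigenmeasure.integral_transfer_pow (hμ : R.IsEigenmeasure l μ) (n : ℕ) (f : C(Y, ℝ)) :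
    ∫ y, (R.transfer ℝ ^ n) f y ∂(μ : Measure Y) = l ^ n * ∫ y, f y ∂(μ : Measure Y) := by
  induction n with
  | zero => simp
  | succ n ih => rw [transfer_pow_succ_apply, hμ, ih, pow_succ', mul_assoc]

theorem HasRatioLimit.integral_eq_zero [Nonempty ι] (hμ : R.HasRatioLimit μ) {f : C(Y, ℝ)}
    (hf : ∀ ε > 0, ∀ᶠ n in atTop, ∀ y, |(R.transfer ℝ ^ n) f y| ≤ ε * (R.transfer ℝ ^ n) 1 y) :
    ∫ y, f y ∂(μ : Measure Y) = 0 := by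
  refine eq_of_forall_dist_le fun ε hε => ?_
  rw [Real.dist_0_eq_abs]
  obtain ⟨y⟩ := μ.nonempty
  obtain ⟨n, hlim, hsmall⟩ :=
    ((hμ f (ε / 2) (half_pos hε)).and (hf (ε / 2) (half_pos hε))).exists
  have hpos : 0 < (R.transfer ℝ ^ n) 1 y := transfer_pow_pos (fun _ => one_pos) n y
  refine le_of_mul_le_mul_right ?_ hpos
  calc |∫ y, f y ∂(μ : Measure Y)| * (R.transfer ℝ ^ n) 1 y
      = |(∫ y, f y ∂(μ : Measure Y)) * (R.transfer ℝ ^ n) 1 y| := by rw [abs_mul, abs_of_pos hpos]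
    _ ≤ |(R.transfer ℝ ^ n) f y - (∫ y, f y ∂(μ : Measure Y)) * (R.transfer ℝ ^ n) 1 y| +
        |(R.transfer ℝ ^ n) f y| := by
          rw [abs_sub_comm]
          linarith [abs_sub_abs_le_abs_sub ((∫ y, f y ∂(μ : Measure Y)) * (R.transfer ℝ ^ n) 1 y)
            ((R.transfer ℝ ^ n) f y)]
    _ ≤ ε / 2 * (R.transfer ℝ ^ n) 1 y + ε / 2 * (R.transfer ℝ ^ n) 1 y :=
        add_le_add (hlim y) (hsmall y)
    _ = ε * (R.transfer ℝ ^ n) 1 y := by ring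

theorem HasRatioLimit.eq_smul_of_eigenfunction (hμ : R.HasRatioLimit μ) (hl : 0 < l) {h g : C(Y, ℝ)}
    (hlim : Tendsto (R.normalizedIterate l) atTop (𝓝 h))
    (hg : R.transfer ℝ g = l • g) : g = (∫ y, g y ∂(μ : Measure Y)) • h := by
  ext y
  set a := ∫ y, g y ∂(μ : Measure Y)
  have hlimy : Tendsto (fun n => (l ^ n)⁻¹ * (R.transfer ℝ ^ n) 1 y) atTop (𝓝 (h y)) :=
    ((continuous_eval_const y).tendsto h).comp hlim
  have hle (ε : ℝ) (hε : 0 < ε) : |g y - a * h y| ≤ ε * h y := by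
    refine le_of_tendsto_of_tendsto (hlimy.const_mul a |>.const_sub (g y)).abs
      (hlimy.const_mul ε) ?_
    filter_upwards [hμ g ε hε] with n hn
    have hpow : 0 < (l ^ n)⁻¹ := inv_pos.2 (pow_pos hl n)
    have hgy : (l ^ n)⁻¹ * (R.transfer ℝ ^ n) g y = g y := by
      rw [transfer_pow_eigenfunction hg, ContinuousMap.smul_apply, smul_eq_mul,
        inv_mul_cancel_left₀ (pow_pos hl n).ne']
    calc |g y - a * ((l ^ n)⁻¹ * (R.transfer ℝ ^ n) 1 y)|
        = (l ^ n)⁻¹ * |(R.transfer ℝ ^ n) g y - a * (R.transfer ℝ ^ n) 1 y| := by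
          rw [← abs_of_pos hpow, ← abs_mul, abs_of_pos hpow, mul_sub, hgy, mul_left_comm]
      _ ≤ (l ^ n)⁻¹ * (ε * (R.transfer ℝ ^ n) 1 y) := mul_le_mul_of_nonneg_left (hn y) hpow.le
      _ = ε * ((l ^ n)⁻¹ * (R.transfer ℝ ^ n) 1 y) := mul_left_comm _ _ _
  have hzero : Tendsto (fun ε => ε * h y) (𝓝[>] 0) (𝓝 0) := by
    have h : Tendsto (fun ε => ε * h y) (𝓝 0) (𝓝 (0 * h y)) :=
      (continuous_mul_const (h y)).tendsto 0
    rw [zero_mul] at h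
    exact h.mono_left nhdsWithin_le_nhds
  exact sub_eq_zero.1 <| abs_nonpos_iff.1 <|
    ge_of_tendsto hzero <| eventually_mem_nhdsWithin.mono hle

variable [BorelSpace Y]

theorem integral_pos_of_forall_pos {f : C(Y, ℝ)} (hf : ∀ y, 0 < f y) :
    0 < ∫ y, f y ∂(μ : Measure Y) := by
  rw [integral_pos_iff_support_of_nonneg (fun y => (hf y).le) (integrable_continuousMap _ f),
    Function.support_eq_univ fun y => (hf y).ne', measure_univ]
  exact one_pos

theorem IsEigenmeasure.pos [Nonempty ι] (hμ : R.IsEigenmeasure l μ) : 0 < l := by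
  have h := integral_pos_of_forall_pos (μ := μ) (transfer_pos (R := R) (f := 1) fun _ => one_pos)
  simpa [hμ 1] using h

theorem IsEigenmeasure.dualTransfer_eq [HasOuterApproxClosed Y] (hl : 0 ≤ l)
    (hμ : R.IsEigenmeasure l μ) : R.dualTransfer μ = ENNReal.ofReal l • (μ : Measure Y) := by
  have := (μ : Measure Y).smul_finite (ENNReal.ofReal_ne_top (r := l))
  refine ext_of_forall_integral_eq_of_IsFiniteMeasure fun f => ?_
  rw [integral_smul_measure, ENNReal.toReal_ofReal hl, smul_eq_mul]
  exact (integral_dualTransfer _ f.toContinuousMap).trans (hμ f.toContinuousMap)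

namespace HasRatioLimit

theorem isEigenmeasure [Nonempty ι] (hμ : R.HasRatioLimit μ) :
    R.IsEigenmeasure (∫ y, R.transfer ℝ 1 y ∂(μ : Measure Y)) μ := by
  intro g
  set a := ∫ y, g y ∂(μ : Measure Y)
  have hzero := hμ.integral_eq_zero (f := R.transfer ℝ (g - a • 1)) fun ε hε => ?_
  · simp only [map_sub, map_smul, ContinuousMap.sub_apply, ContinuousMap.smul_apply,
      smul_eq_mul] at hzero
    rw [integral_sub (integrable_continuousMap _ _) ((integrable_continuousMap _ _).const_mul a),
      integral_const_mul, sub_eq_zero] at hzero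
    rw [hzero, mul_comm]
  · have hN : 0 < ‖R.transfer ℝ 1‖ + 1 := by positivity
    filter_upwards [hμ g (ε / (‖R.transfer ℝ 1‖ + 1)) (div_pos hε hN)] with n hn y
    have hpos : 0 < (R.transfer ℝ ^ n) 1 y := transfer_pow_pos (fun _ => one_pos) n y
    refine (abs_transfer_pow_transfer_le (div_pos hε hN).le (fun x => ?_) y).trans
      (mul_le_mul_of_nonneg_right ?_ hpos.le) (b := ε / (‖R.transfer ℝ 1‖ + 1) * ‖R.transfer ℝ 1‖ *
        (R.transfer ℝ ^ n) 1 y)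
    · rw [map_sub, map_smul]
      exact hn x
    · rw [div_mul_eq_mul_div, div_le_iff₀ hN]
      exact mul_le_mul_of_nonneg_left (le_add_of_nonneg_right zero_le_one) hε.le

theorem integral_eq_of_isEigenmeasure [Nonempty ι] (hμ : R.HasRatioLimit μ)
    (hν : R.IsEigenmeasure l ν) (g : C(Y, ℝ)) :
    ∫ y, g y ∂(ν : Measure Y) = ∫ y, g y ∂(μ : Measure Y) := by
  have hl := hν.pos
  set a := ∫ y, g y ∂(μ : Measure Y)
  refine eq_of_forall_dist_le fun ε hε => ?_
  obtain ⟨n, hn⟩ := (hμ g ε hε).exists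
  have hpow : 0 < l ^ n := pow_pos hl n
  have hint : ‖∫ y, ((R.transfer ℝ ^ n) g y - a * (R.transfer ℝ ^ n) 1 y) ∂(ν : Measure Y)‖ ≤
      ∫ y, ε * (R.transfer ℝ ^ n) 1 y ∂(ν : Measure Y) :=
    norm_integral_le_of_norm_le ((integrable_continuousMap _ _).const_mul ε)
      (Eventually.of_forall hn)
  rw [integral_sub (integrable_continuousMap _ _) ((integrable_continuousMap _ _).const_mul a),
    integral_const_mul, integral_const_mul, hν.integral_transfer_pow,
    hν.integral_transfer_pow] at hint
  simp only [ContinuousMap.one_apply, integral_const, probReal_univ, smul_eq_mul, mul_one] at hint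
  rw [mul_comm a, ← mul_sub, Real.norm_eq_abs, abs_mul, abs_of_pos hpow, mul_comm ε] at hint
  exact le_of_mul_le_mul_left hint hpow

theorem eq_of_isEigenmeasure [Nonempty ι] [HasOuterApproxClosed Y] (hμ : R.HasRatioLimit μ)
    (hν : R.IsEigenmeasure l ν) : ν = μ := by
  have h : (ν : Measure Y) = μ := ext_of_forall_integral_eq_of_IsFiniteMeasure fun g =>
    hμ.integral_eq_of_isEigenmeasure hν g.toContinuousMap
  exact Subtype.ext h

end HasRatioLimit

end Perron

section Eigenfunction

variable {Y ι : Type*} [TopologicalSpace Y] [CompactSpace Y]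
variable [Fintype ι] {R : WeightedIFS Y ι} {D : Y → Y → ℝ} {A l : ℝ}

theorem transfer_normalizedIterate (hl : l ≠ 0) (n : ℕ) :
    R.transfer ℝ (R.normalizedIterate l n) = l • R.normalizedIterate l (n + 1) := by
  have hpow : (l ^ n)⁻¹ = l * (l ^ (n + 1))⁻¹ := by field_simp; rw [pow_succ]
  rw [normalizedIterate, normalizedIterate, map_smul, ← mul_apply_eq_comp, ← pow_succ', smul_smul,
    hpow]

theorem ContractsDistortion.normalizedIterate_mem (hR : R.ContractsDistortion D A) (hl : 0 < l)
    (n : ℕ) : R.normalizedIterate l n ∈ distortionCone D A :=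
  smul_mem_distortionCone (hR.transfer_pow_one_mem n) (inv_pos.2 (pow_pos hl n)).le

variable [MeasurableSpace Y] {μ : ProbabilityMeasure Y}

theorem IsEigenmeasure.integral_normalizedIterate (hμ : R.IsEigenmeasure l μ) (hl : l ≠ 0) (n : ℕ) :
    ∫ y, R.normalizedIterate l n y ∂(μ : Measure Y) = 1 := by
  simp only [normalizedIterate, ContinuousMap.smul_apply, smul_eq_mul]
  rw [integral_const_mul, hμ.integral_transfer_pow]
  simp [hl]

variable [BorelSpace Y]

theorem IsUnitGauge.mem_Icc_of_integral_eq_one (hD : IsUnitGauge D) (hA : 0 ≤ A) {f : C(Y, ℝ)}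
    (hf : f ∈ distortionCone D A) (hint : ∫ y, f y ∂(μ : Measure Y) = 1) (y : Y) :
    f y ∈ Set.Icc (Real.exp (-A)) (Real.exp A) := by
  have hlow := integral_mono (integrable_continuousMap (μ : Measure Y) f) (integrable_const _)
    fun x => hD.le_exp_mul hA hf x y
  have hupp := integral_mono (integrable_const _)
    ((integrable_continuousMap (μ : Measure Y) f).const_mul _) fun z => hD.le_exp_mul hA hf y z
  rw [integral_const_mul] at hupp
  simp only [hint, integral_const, probReal_univ, smul_eq_mul, one_mul, mul_one] at hlow hupp
  refine ⟨?_, hupp⟩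
  rwa [Real.exp_neg, inv_le_iff_one_le_mul₀' (Real.exp_pos A)]

variable [Nonempty ι]

theorem ContractsDistortion.normalizedIterate_mem_Icc (hR : R.ContractsDistortion D A)
    (hμ : R.IsEigenmeasure l μ) (n : ℕ) (y : Y) :
    R.normalizedIterate l n y ∈ Set.Icc (Real.exp (-A)) (Real.exp A) :=
  hR.mem_Icc_of_integral_eq_one (zero_le_one.trans hR.one_le) (hR.normalizedIterate_mem hμ.pos n)
    (hμ.integral_normalizedIterate hμ.pos.ne' n) y

theorem ContractsDistortion.cauchySeq_normalizedIterate [Nonempty Y]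
    (hR : R.ContractsDistortion D A)
    (hmean : R.IsRatioMean μ) (hμ : R.IsEigenmeasure l μ) : CauchySeq (R.normalizedIterate l) := by
  have hA : 0 ≤ A := zero_le_one.trans hR.one_le
  have hl := hμ.pos
  obtain ⟨E, hE⟩ := hR.abs_sub_integral_mul_le hmean <|
    hR.distortionCone_subset_gaugeLipschitz hA <| hR.transfer_mem_self <|
      hR.one_mem_distortionCone hA
  have hE0 : 0 ≤ E := by
    simpa using (abs_nonneg _).trans (hE 0 (Classical.arbitrary Y))
  have hrate := bracketRate_nonneg hR.one_le
  refine cauchySeq_of_le_geometric (bracketRate A) (l⁻¹ * E * Real.exp A)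
    (bracketRate_lt_one hR.one_le) fun n => ?_
  rw [dist_comm, ContinuousMap.dist_le (by positivity)]
  intro y
  have hint : ∫ x, R.transfer ℝ 1 x ∂(μ : Measure Y) = l := by simp [hμ 1]
  have hE' := hE n y
  rw [hint, ← mul_apply_eq_comp, ← pow_succ] at hE'
  have hinv : 0 < (l ^ (n + 1))⁻¹ := inv_pos.2 (pow_pos hl _)
  calc dist (R.normalizedIterate l (n + 1) y) (R.normalizedIterate l n y)
      = (l ^ (n + 1))⁻¹ * |(R.transfer ℝ ^ (n + 1)) 1 y - l * (R.transfer ℝ ^ n) 1 y| := by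
        have hpow : (l ^ n)⁻¹ = (l ^ (n + 1))⁻¹ * l := by field_simp; rw [pow_succ]
        simp only [normalizedIterate, ContinuousMap.smul_apply, smul_eq_mul]
        rw [hpow, mul_assoc, Real.dist_eq, ← mul_sub, abs_mul, abs_of_pos hinv]
    _ ≤ (l ^ (n + 1))⁻¹ * (E * bracketRate A ^ n * (R.transfer ℝ ^ n) 1 y) :=
        mul_le_mul_of_nonneg_left hE' hinv.le
    _ = l⁻¹ * E * bracketRate A ^ n * R.normalizedIterate l n y := by
        simp only [normalizedIterate, ContinuousMap.smul_apply, smul_eq_mul, pow_succ, mul_inv_rev]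
        ring
    _ ≤ l⁻¹ * E * bracketRate A ^ n * Real.exp A := by
        gcongr
        exact (hR.normalizedIterate_mem_Icc hμ n y).2
    _ = _ := by ring

/-- `h` is a positive eigenfunction, normalized against `μ`, and the limit of the normalized
iterates. -/
structure IsLeadingEigenfunction (R : WeightedIFS Y ι) (l : ℝ) (μ : ProbabilityMeasure Y)
    (h : C(Y, ℝ)) : Prop where
  tendsto : Tendsto (R.normalizedIterate l) atTop (𝓝 h)
  pos : ∀ y, 0 < h y
  eigenfunction : R.transfer ℝ h = l • h
  normalized : ∫ y, h y ∂(μ : Measure Y) = 1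

theorem ContractsDistortion.exists_isLeadingEigenfunction [Nonempty Y]
    (hR : R.ContractsDistortion D A) (hmean : R.IsRatioMean μ) (hμ : R.IsEigenmeasure l μ) :
    ∃ h, R.IsLeadingEigenfunction l μ h := by
  obtain ⟨h, hlim⟩ := cauchySeq_tendsto_of_complete (hR.cauchySeq_normalizedIterate hmean hμ)
  have hlimy (y : Y) : Tendsto (fun n => R.normalizedIterate l n y) atTop (𝓝 (h y)) :=
    ((continuous_eval_const y).tendsto h).comp hlim
  have hbound := hR.normalizedIterate_mem_Icc hμ
  refine ⟨h, hlim, fun y => (Real.exp_pos (-A)).trans_le <|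
    ge_of_tendsto' (hlimy y) fun n => (hbound n y).1, ?_, ?_⟩
  · refine tendsto_nhds_unique (((R.transfer ℝ).continuous.tendsto h).comp hlim) ?_
    simp only [Function.comp_def, transfer_normalizedIterate hμ.pos.ne']
    exact (hlim.comp (tendsto_add_atTop_nat 1)).const_smul l
  · refine tendsto_nhds_unique (tendsto_integral_filter_of_norm_le_const
      (Eventually.of_forall fun n => (integrable_continuousMap _ _).1)
      ⟨Real.exp A, Eventually.of_forall fun n => Eventually.of_forall fun y => ?_⟩
      (Eventually.of_forall hlimy)) ?_
    · rw [Real.norm_of_nonneg ((Real.exp_pos _).le.trans (hbound n y).1)]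
      exact (hbound n y).2
    · simp only [hμ.integral_normalizedIterate hμ.pos.ne', tendsto_const_nhds]

theorem ContractsDistortion.rho_pos_and_existsUnique_isPerronPair [Nonempty Y] [T2Space Y]
    [HasOuterApproxClosed Y] (hR : R.ContractsDistortion D A)
    (hsep : (gaugeLipschitz D).SeparatesPoints) :
    0 < R.rho ∧ ∃! p : C(Y, ℝ) × ProbabilityMeasure Y, R.IsPerronPair p.1 p.2 := by
  obtain ⟨μ, hmean⟩ := exists_isRatioMean R
  have hratio := hR.hasRatioLimit hsep hmean
  have hμ := hratio.isEigenmeasure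
  obtain ⟨h, hh⟩ := hR.exists_isLeadingEigenfunction hmean hμ
  have hρ := rho_eq_of_eigenfunction hμ.pos hh.pos hh.eigenfunction
  rw [← hρ] at hh hμ
  refine ⟨hμ.pos, (h, μ), ⟨hh.pos, hh.eigenfunction, hμ, hh.normalized⟩, ?_⟩
  rintro ⟨g, ν⟩ hp
  obtain rfl : ν = μ := hratio.eq_of_isEigenmeasure hp.eigenmeasure
  have hg := hratio.eq_smul_of_eigenfunction hμ.pos hh.tendsto hp.eigenfunction
  rw [hp.normalized, one_smul] at hg
  exact Prod.ext hg rfl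

end Eigenfunction

/-! ### Attractors and Dini weights -/

section Contraction

variable {Y ι : Type*} [TopologicalSpace Y] {R : WeightedIFS Y ι} {D : Y → Y → ℝ}
variable {K K' : TopologicalSpace.NonemptyCompacts Y}

theorem exists_dist_le_pow_of_isAttractor (hD : IsUnitGauge D) {L : ℝ} (hL0 : 0 ≤ L)
    (hmap : ∀ i y z, D (R.map i y) (R.map i z) ≤ L * D y z) (hK : R.IsAttractor K)
    (hK' : R.IsAttractor K') (n : ℕ) {x : Y} (hx : x ∈ K) : ∃ y ∈ K', D x y ≤ L ^ n := by
  induction n generalizing x with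
  | zero =>
    obtain ⟨y, hy⟩ := K'.nonempty
    exact ⟨y, hy, by simpa using hD.le_one x y⟩
  | succ n ih =>
    have hx' : x ∈ ⋃ i, R.map i '' (K : Set Y) := by rwa [show _ = _ from hK]
    obtain ⟨i, z, hz, rfl⟩ := Set.mem_iUnion.1 hx'
    obtain ⟨y, hy, hzy⟩ := ih hz
    refine ⟨R.map i y, hK'.map_mem i ⟨y, hy⟩, (hmap i z y).trans ?_⟩
    rw [pow_succ']
    exact mul_le_mul_of_nonneg_left hzy hL0

theorem IsContractive.isAttractor_subset [T2Space Y] (hR : R.IsContractive D) (hD : IsUnitGauge D)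
    (hlim : ∀ (x : Y) (y : ℕ → Y), Tendsto (fun n => D x (y n)) atTop (𝓝 0) →
      Tendsto y atTop (𝓝 x)) (hK : R.IsAttractor K) (hK' : R.IsAttractor K') :
    (K : Set Y) ⊆ K' := by
  obtain ⟨L, hL0, hL1, hmap⟩ := hR
  intro x hx
  choose y hy hxy using fun n => exists_dist_le_pow_of_isAttractor hD hL0 hmap hK hK' n hx
  exact K'.isCompact.isClosed.mem_of_tendsto (hlim x y <|
    squeeze_zero (fun _ => hD.nonneg _ _) hxy <|
      tendsto_pow_atTop_nhds_zero_of_lt_one hL0 hL1) (Eventually.of_forall hy)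

theorem hasDiniWeights_of_abs_log_weight_sub_le (hD : IsUnitGauge D) {α C : ℝ} (hα : 0 < α)
    (hC : 0 ≤ C)
    (hw : ∀ i x z, |Real.log (R.weight i x) - Real.log (R.weight i z)| ≤ C * D x z ^ α) :
    R.HasDiniWeights D := by
  intro i
  have hint : IntegrableOn (fun t : ℝ => C * t ^ (α - 1)) (Set.Ioc 0 1) :=
    ((intervalIntegrable_iff_integrableOn_Ioc_of_le zero_le_one).1
      (intervalIntegral.intervalIntegrable_rpow' (by linarith))).const_mul C
  refine (setLIntegral_mono' measurableSet_Ioc fun t ht => ?_).trans_lt hint.lintegral_lt_top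
  refine iSup_le fun y => iSup_le fun z => iSup_le fun hyz => ENNReal.ofReal_le_ofReal ?_
  rw [div_le_iff₀ ht.1, mul_assoc, ← Real.rpow_add_one ht.1.ne', sub_add_cancel]
  exact (hw i y z).trans <|
    mul_le_mul_of_nonneg_left (Real.rpow_le_rpow (hD.nonneg y z) hyz hα.le) hC

end Contraction

end WeightedIFS

/-! ### The symbolic metric -/

section SymDist

variable {d : ℕ} {θ : ℝ} {x z : SymbolicSpace d}

theorem isUnitGauge_symDist (hθ0 : 0 ≤ θ) (hθ1 : θ ≤ 1) :
    WeightedIFS.IsUnitGauge (symDist (d := d) θ) where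
  nonneg x z := by
    unfold symDist
    split_ifs <;> positivity
  le_one x z := by
    unfold symDist
    split_ifs
    exacts [zero_le_one, pow_le_one₀ hθ0 hθ1]
  symm x z := by
    rcases eq_or_ne x z with rfl | h
    · rfl
    · rw [symDist, symDist, if_neg h, if_neg h.symm, PiNat.firstDiff_comm]

theorem pow_le_symDist (hθ0 : 0 ≤ θ) (hθ1 : θ ≤ 1) {n : ℕ} (h : x n ≠ z n) :
    θ ^ (n + 1) ≤ symDist θ x z := by
  rw [symDist, if_neg fun hxz => h (congrFun hxz n)]
  refine pow_le_pow_of_le_one hθ0 hθ1 (Nat.succ_le_succ ?_)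
  by_contra! hlt
  exact h (PiNat.apply_eq_of_lt_firstDiff hlt)

theorem tendsto_of_tendsto_symDist (hθ0 : 0 < θ) (hθ1 : θ ≤ 1) {y : ℕ → SymbolicSpace d}
    (h : Tendsto (fun n => symDist θ x (y n)) atTop (𝓝 0)) : Tendsto y atTop (𝓝 x) := by
  refine tendsto_pi_nhds.2 fun i => tendsto_const_nhds.congr' ?_
  filter_upwards [h.eventually_lt_const (pow_pos hθ0 (i + 1))] with n hn
  by_contra hne
  exact hn.not_ge (pow_le_symDist hθ0.le hθ1 hne)

theorem separatesPoints_gaugeLipschitz_symDist_rpow {Y : Type*} [TopologicalSpace Y]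
    [CompactSpace Y] {e : Y → SymbolicSpace d} (he : Continuous e) (hinj : Function.Injective e)
    (hθ0 : 0 < θ) (hθ1 : θ ≤ 1) {α : ℝ} (hα : 0 ≤ α) :
    (WeightedIFS.gaugeLipschitz fun x z : Y => symDist θ (e x) (e z) ^ α).SeparatesPoints := by
  intro x y hxy
  obtain ⟨n, hn⟩ := Function.ne_iff.1 (hinj.ne hxy)
  let g : C(Y, ℝ) := ⟨fun w => Set.indicator {e x n} 1 (e w n),
    (continuous_of_discreteTopology (f := Set.indicator {e x n} (1 : Fin d → ℝ))).comp
      ((continuous_apply n).comp he)⟩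
  refine ⟨g, ⟨g, ⟨((θ ^ (n + 1)) ^ α)⁻¹, fun w z => ?_⟩, rfl⟩, ?_⟩
  · have hpos : 0 < (θ ^ (n + 1)) ^ α := by positivity
    rw [← div_eq_inv_mul]
    by_cases hwz : e w n = e z n
    · have hg : g w = g z := by simp [g, hwz]
      rw [hg, sub_self, abs_zero]
      exact div_nonneg (Real.rpow_nonneg ((isUnitGauge_symDist hθ0.le hθ1).nonneg _ _) α) hpos.le
    · have hg : |g w - g z| ≤ 1 := by
        simp only [g, ContinuousMap.coe_mk, Set.indicator_apply]
        split_ifs <;> simp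
      refine hg.trans ((one_le_div hpos).2 ?_)
      exact Real.rpow_le_rpow (by positivity) (pow_le_symDist hθ0.le hθ1 hwz) hα
  · simp [g, hn.symm]

end SymDist

/-! ### The system attached to a representation -/

section Shift

variable {d : ℕ}

/-- The shift `(x₁, x₂, …) ↦ (x₂, x₃, …)`. -/
def shift (x : SymbolicSpace d) : SymbolicSpace d := fun n => x (n + 1)

theorem concat_zero_shift (x : SymbolicSpace d) : concat (x 0) (shift x) = x := by
  funext n
  cases n <;> rfl

theorem measurable_shift : Measurable (shift (d := d)) :=
  measurable_pi_lambda _ fun n => measurable_pi_apply (n + 1)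

end Shift

namespace IsRepresentation

variable {d : ℕ} {r : Setoid (SymbolicSpace d)} {k : Fin d → ℕ}
  {ψ : (j : Fin d) → Fin (k j) → C(SymbolicSpace d, SymbolicSpace d)}

theorem rel_concat_iff (hψ : IsRepresentation r ψ) {j : Fin d} {s x : SymbolicSpace d} :
    r s (concat j x) ↔ ∃ i, ψ j i x = s :=
  (Set.ext_iff.1 (hψ j x).2 s).symm

theorem rel_iff (hψ : IsRepresentation r ψ) {s x : SymbolicSpace d} :
    r s x ↔ ∃ i, ψ (x 0) i (shift x) = s := by
  rw [← hψ.rel_concat_iff, concat_zero_shift]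

theorem nonempty_index [Nonempty (SymbolicSpace d)] (hψ : IsRepresentation r ψ) :
    Nonempty ((j : Fin d) × Fin (k j)) :=
  let x : SymbolicSpace d := Classical.arbitrary _
  let ⟨i, _⟩ := hψ.rel_iff.1 (r.refl x)
  ⟨⟨x 0, i⟩⟩

variable {V : C(SymbolicSpace d, ℝ)} {β : ℝ}

theorem isAttractor_top [Nonempty (SymbolicSpace d)] (hψ : IsRepresentation r ψ) :
    (haarIFS ψ V β).IsAttractor ⊤ := by
  refine Set.eq_univ_of_forall fun x => ?_
  obtain ⟨i, hi⟩ := hψ.rel_iff.1 (r.refl x)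
  exact Set.mem_iUnion.2 ⟨⟨x 0, i⟩, _, Set.mem_univ _, hi⟩

theorem existsUnique_isAttractor [Nonempty (SymbolicSpace d)] (hψ : IsRepresentation r ψ) {θ : ℝ}
    (hθ0 : 0 < θ) (hθ1 : θ ≤ 1) (hR : (haarIFS ψ V β).IsContractive (symDist θ)) :
    ∃! K : TopologicalSpace.NonemptyCompacts (SymbolicSpace d), (haarIFS ψ V β).IsAttractor K := by
  have hsub := fun K K' => hR.isAttractor_subset (K := K) (K' := K')
    (isUnitGauge_symDist hθ0.le hθ1) fun _ _ => tendsto_of_tendsto_symDist hθ0 hθ1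
  exact ⟨⊤, hψ.isAttractor_top, fun K hK => SetLike.coe_injective <|
    (hsub K ⊤ hK hψ.isAttractor_top).antisymm (hsub ⊤ K hψ.isAttractor_top hK)⟩

end IsRepresentation

section HolderWeights

variable {d : ℕ} {θ L α C : ℝ} {k : Fin d → ℕ}
  {ψ : (j : Fin d) → Fin (k j) → C(SymbolicSpace d, SymbolicSpace d)}
  {V : C(SymbolicSpace d, ℝ)} {β : ℝ}

theorem abs_log_haarIFS_weight_sub_le (hθ0 : 0 ≤ θ) (hθ1 : θ ≤ 1) (hL1 : L ≤ 1)
    (hL : ∀ p x z, symDist θ ((haarIFS ψ V β).map p x) ((haarIFS ψ V β).map p z) ≤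
      L * symDist θ x z)
    (hα : 0 ≤ α) (hV : ∀ x z, |V x - V z| ≤ C * symDist θ x z ^ α)
    (p : (j : Fin d) × Fin (k j)) (x z : SymbolicSpace d) :
    |Real.log ((haarIFS ψ V β).weight p x) - Real.log ((haarIFS ψ V β).weight p z)| ≤
      |β| * |C| * symDist θ x z ^ α := by
  have hsd := isUnitGauge_symDist (d := d) hθ0 hθ1
  have hmap : symDist θ (ψ p.1 p.2 x) (ψ p.1 p.2 z) ≤ symDist θ x z :=
    (hL p x z).trans (mul_le_of_le_one_left (hsd.nonneg x z) hL1)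
  calc |Real.log ((haarIFS ψ V β).weight p x) - Real.log ((haarIFS ψ V β).weight p z)|
      = |β| * |V (ψ p.1 p.2 x) - V (ψ p.1 p.2 z)| := by
        simp only [haarIFS, ContinuousMap.coe_mk, Real.log_exp]
        rw [← mul_sub, abs_mul, abs_neg]
    _ ≤ |β| * (|C| * symDist θ x z ^ α) := by
        refine mul_le_mul_of_nonneg_left ((hV _ _).trans ?_) (abs_nonneg β)
        exact mul_le_mul (le_abs_self C) (Real.rpow_le_rpow (hsd.nonneg _ _) hmap hα)
          (Real.rpow_nonneg (hsd.nonneg _ _) α) (abs_nonneg C)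
    _ = |β| * |C| * symDist θ x z ^ α := (mul_assoc _ _ _).symm

theorem exists_contractsDistortion_restrict_haarIFS (hθ0 : 0 ≤ θ) (hθ1 : θ ≤ 1) (hL0 : 0 ≤ L)
    (hL1 : L < 1)
    (hL : ∀ p x z, symDist θ ((haarIFS ψ V β).map p x) ((haarIFS ψ V β).map p z) ≤
      L * symDist θ x z)
    (hα : 0 < α) (hV : ∀ x z, |V x - V z| ≤ C * symDist θ x z ^ α)
    {K : TopologicalSpace.NonemptyCompacts (SymbolicSpace d)} (hK : (haarIFS ψ V β).IsAttractor K) :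
    ∃ A, ((haarIFS ψ V β).restrict K hK).ContractsDistortion
      (fun x z : K => symDist θ x.1 z.1 ^ α) A := by
  have hsd := isUnitGauge_symDist (d := d) hθ0 hθ1
  refine ⟨_, WeightedIFS.contractsDistortion_of_abs_log_weight_sub_le
    ((hsd.rpow hα.le).comp Subtype.val) (Real.rpow_nonneg hL0 α) (Real.rpow_lt_one hL0 hL1 hα)
    (mul_nonneg (abs_nonneg β) (abs_nonneg C)) (fun p x z => ?_) fun p x z =>
      abs_log_haarIFS_weight_sub_le hθ0 hθ1 hL1.le hL hα.le hV p x z⟩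
  rw [← Real.mul_rpow hL0 (hsd.nonneg _ _)]
  exact Real.rpow_le_rpow (hsd.nonneg _ _) (hL p x z) hα.le

end HolderWeights

/-! ### Quasi-invariance -/

theorem hasOuterApproxClosed_nonemptyCompacts {X : Type*} [TopologicalSpace X]
    [TopologicalSpace.MetrizableSpace X] [MeasurableSpace X] [BorelSpace X]
    (K : TopologicalSpace.NonemptyCompacts X) : HasOuterApproxClosed K := by
  have : TopologicalSpace.MetrizableSpace K :=
    inferInstanceAs (TopologicalSpace.MetrizableSpace (K : Set X))
  let := TopologicalSpace.metrizableSpaceMetric K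
  infer_instance

namespace WeightedIFS

section Conformal

variable {Y ι : Type*} [TopologicalSpace Y] [MeasurableSpace Y] [BorelSpace Y] [Fintype ι]
variable {R : WeightedIFS Y ι} {K : TopologicalSpace.NonemptyCompacts Y}

theorem dualTransfer_map_val (hK : R.IsAttractor K) (μ : Measure K) :
    R.dualTransfer (μ.map Subtype.val) = ((R.restrict K hK).dualTransfer μ).map Subtype.val := by
  refine Measure.ext_of_lintegral _ fun f hf => ?_
  have (i : ι) : Measurable fun y => f (R.map i y) := hf.comp (R.map i).continuous.measurable
  rw [lintegral_dualTransfer _ hf, lintegral_map (by fun_prop) measurable_subtype_coe,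
    lintegral_map hf measurable_subtype_coe]
  exact (lintegral_dualTransfer (R := R.restrict K hK) μ (hf.comp measurable_subtype_coe)).symm

theorem IsPerronPair.dualTransfer_map_val [Nonempty ι] [HasOuterApproxClosed K]
    {hK : R.IsAttractor K} {h : C(K, ℝ)} {μ : ProbabilityMeasure K}
    (hp : (R.restrict K hK).IsPerronPair h μ) :
    R.dualTransfer ((μ : Measure K).map Subtype.val) =
      ENNReal.ofReal (R.restrict K hK).rho • (μ : Measure K).map Subtype.val := by
  have hμ : (R.restrict K hK).IsEigenmeasure (R.restrict K hK).rho μ := hp.eigenmeasure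
  rw [WeightedIFS.dualTransfer_map_val hK, hμ.dualTransfer_eq hμ.pos.le, Measure.map_smul]

end Conformal

end WeightedIFS

section GibbsCocycle

variable {d : ℕ}

/-- The Radon-Nikodym cocycle `e ^ (-β (V s - V x))`, extended to all pairs `(x, s)`. -/
noncomputable def gibbsCocycle (V : C(SymbolicSpace d, ℝ)) (β : ℝ)
    (p : SymbolicSpace d × SymbolicSpace d) : ℝ :=
  Real.exp (-β * (V p.2 - V p.1))

theorem measurable_gibbsCocycle (V : C(SymbolicSpace d, ℝ)) (β : ℝ) :
    Measurable (gibbsCocycle V β) := by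
  unfold gibbsCocycle
  fun_prop

end GibbsCocycle

namespace IsRepresentation

variable {d : ℕ} {r : Setoid (SymbolicSpace d)} {k : Fin d → ℕ}
  {ψ : (j : Fin d) → Fin (k j) → C(SymbolicSpace d, SymbolicSpace d)}

theorem transverse_eq_of_rel_concat (hψ : IsRepresentation r ψ) {j : Fin d} {x y : SymbolicSpace d}
    (h : r y (concat j x)) : transverse r y = ∑ i, Measure.dirac (ψ j i x) := by
  have hclass : {s | r s y} = ((Finset.univ.map ⟨_, (hψ j x).1⟩ : Finset (SymbolicSpace d)) :
      Set (SymbolicSpace d)) := by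
    rw [Finset.coe_map, Finset.coe_univ, Set.image_univ]
    refine .trans ?_ (hψ j x).2.symm
    ext s
    exact ⟨fun hs => r.trans hs h, fun hs => r.trans hs (r.symm h)⟩
  ext A hA
  rw [transverse, hclass, ← lintegral_indicator_one hA, lintegral_finset, Finset.sum_map]
  simp [Measure.dirac_apply' _ hA]

theorem transverse_eq (hψ : IsRepresentation r ψ) (x : SymbolicSpace d) :
    transverse r x = ∑ i, Measure.dirac (ψ (x 0) i (shift x)) :=
  hψ.transverse_eq_of_rel_concat (by rw [concat_zero_shift])

theorem measurable_transverse (hψ : IsRepresentation r ψ) : Measurable (transverse r) := by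
  have hlist : Measurable fun p : Fin d × SymbolicSpace d =>
      ∑ i, Measure.dirac (ψ p.1 i p.2) := by
    refine measurable_from_prod_countable_right fun j => ?_
    change Measurable fun x => ∑ i, Measure.dirac (ψ j i x)
    refine Measure.measurable_of_measurable_coe _ fun A hA => ?_
    simp only [Measure.finsetSum_apply]
    exact Finset.measurable_fun_sum _ fun i _ => (Measure.measurable_coe hA).comp
      (Measure.measurable_dirac.comp (ψ j i).continuous.measurable)
  simp_rw [funext hψ.transverse_eq]
  exact hlist.comp ((measurable_pi_apply 0).prodMk measurable_shift)

theorem measurableSet_rel (hψ : IsRepresentation r ψ) :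
    MeasurableSet {p : SymbolicSpace d × SymbolicSpace d | r p.1 p.2} := by
  have hgraphs : {p : SymbolicSpace d × SymbolicSpace d | r p.1 p.2} =
      ⋃ j, ⋃ i : Fin (k j), {p | p.2 0 = j} ∩ {p | ψ j i (shift p.2) = p.1} := by
    ext ⟨s, x⟩
    simp only [hψ.rel_iff, Set.mem_ofPred_eq, Set.mem_iUnion, Set.mem_inter_iff]
    exact ⟨fun ⟨i, hi⟩ => ⟨x 0, i, rfl, hi⟩, by rintro ⟨j, i, rfl, hi⟩; exact ⟨i, hi⟩⟩
  rw [hgraphs]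
  refine MeasurableSet.iUnion fun j => MeasurableSet.iUnion fun i => MeasurableSet.inter ?_ ?_
  · exact measurableSet_eq_fun ((measurable_pi_apply 0).comp measurable_snd) measurable_const
  · exact measurableSet_eq_fun ((ψ j i).continuous.measurable.comp
      (measurable_shift.comp measurable_snd)) measurable_fst

theorem ae_transverse_rel (hψ : IsRepresentation r ψ) (x : SymbolicSpace d) :
    ∀ᵐ s ∂transverse r x, r s x :=
  ae_restrict_mem (hψ.measurableSet_rel.preimage measurable_prodMk_right)

/-- The transverse function `x ↦ ν^x` as a kernel. -/
noncomputable def transverseKernel (hψ : IsRepresentation r ψ) :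
    ProbabilityTheory.Kernel (SymbolicSpace d) (SymbolicSpace d) :=
  ⟨transverse r, hψ.measurable_transverse⟩

theorem transverseKernel_apply (hψ : IsRepresentation r ψ) (x : SymbolicSpace d) :
    hψ.transverseKernel x = transverse r x :=
  rfl

instance isFiniteKernel_transverseKernel (hψ : IsRepresentation r ψ) :
    ProbabilityTheory.IsFiniteKernel hψ.transverseKernel :=
  ⟨∑ j, (k j : ℝ≥0∞), ENNReal.sum_lt_top.2 fun j _ => ENNReal.natCast_lt_top (k j), fun x => by
    rw [transverseKernel_apply, hψ.transverse_eq]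
    simpa using Finset.single_le_sum (f := fun j => (k j : ℝ≥0∞)) (fun _ _ => zero_le)
      (Finset.mem_univ (x 0))⟩

variable {V : C(SymbolicSpace d, ℝ)} {β : ℝ}

theorem sum_weight_mul_lintegral_transverse (hψ : IsRepresentation r ψ)
    (g : SymbolicSpace d → SymbolicSpace d → ℝ≥0∞) (x : SymbolicSpace d) :
    ∑ p, ENNReal.ofReal ((haarIFS ψ V β).weight p x) *
        ∫⁻ s, g ((haarIFS ψ V β).map p x) s ∂transverse r ((haarIFS ψ V β).map p x) =
      ∑ j, ∑ i, ∑ i', ENNReal.ofReal (Real.exp (-β * V (ψ j i x))) * g (ψ j i x) (ψ j i' x) := by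
  rw [Fintype.sum_sigma]
  refine Finset.sum_congr rfl fun j _ => Finset.sum_congr rfl fun i _ => ?_
  simp only [haarIFS, ContinuousMap.coe_mk]
  rw [hψ.transverse_eq_of_rel_concat (hψ.rel_concat_iff.2 ⟨i, rfl⟩), lintegral_finsetSum_measure,
    Finset.mul_sum]
  simp only [lintegral_dirac]

theorem sum_weight_mul_lintegral_transverse_swap (hψ : IsRepresentation r ψ)
    (g : SymbolicSpace d → SymbolicSpace d → ℝ≥0∞) (x : SymbolicSpace d) :
    ∑ p, ENNReal.ofReal ((haarIFS ψ V β).weight p x) *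
        ∫⁻ s, g s ((haarIFS ψ V β).map p x) ∂transverse r ((haarIFS ψ V β).map p x) =
      ∑ p, ENNReal.ofReal ((haarIFS ψ V β).weight p x) *
        ∫⁻ s, ENNReal.ofReal (gibbsCocycle V β ((haarIFS ψ V β).map p x, s)) *
          g ((haarIFS ψ V β).map p x) s ∂transverse r ((haarIFS ψ V β).map p x) := by
  rw [hψ.sum_weight_mul_lintegral_transverse fun y s => g s y,
    hψ.sum_weight_mul_lintegral_transverse fun y s =>
      ENNReal.ofReal (gibbsCocycle V β (y, s)) * g y s]
  refine Finset.sum_congr rfl fun j _ => Finset.sum_comm.trans ?_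
  refine Finset.sum_congr rfl fun i _ => Finset.sum_congr rfl fun i' _ => ?_
  rw [← mul_assoc, ← ENNReal.ofReal_mul (Real.exp_pos _).le, gibbsCocycle, ← Real.exp_add]
  ring_nf

variable {M : Measure (SymbolicSpace d)} [SFinite M] {a : ℝ≥0∞}

open scoped ProbabilityTheory

theorem map_swap_compProd_transverseKernel (hψ : IsRepresentation r ψ) (ha0 : a ≠ 0) (ha : a ≠ ∞)
    (hM : (haarIFS ψ V β).dualTransfer M = a • M) :
    (M ⊗ₘ hψ.transverseKernel).map Prod.swap =
      (M ⊗ₘ hψ.transverseKernel).withDensity fun p => ENNReal.ofReal (gibbsCocycle V β p) := by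
  have hw := (measurable_gibbsCocycle V β).ennreal_ofReal
  refine Measure.ext_of_lintegral _ fun g hg => ?_
  have hdual {f : SymbolicSpace d × SymbolicSpace d → ℝ≥0∞} (hf : Measurable f) :
      a * ∫⁻ p, f p ∂(M ⊗ₘ hψ.transverseKernel) =
        ∫⁻ x, ∑ p, ENNReal.ofReal ((haarIFS ψ V β).weight p x) *
          ∫⁻ s, f ((haarIFS ψ V β).map p x, s) ∂transverse r ((haarIFS ψ V β).map p x) ∂M := by
    rw [Measure.lintegral_compProd hf, ← smul_eq_mul, ← lintegral_smul_measure, ← hM,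
      WeightedIFS.lintegral_dualTransfer _ (hf.lintegral_kernel_prod_right')]
    rfl
  rw [lintegral_map hg measurable_swap, lintegral_withDensity_eq_lintegral_mul _ hw hg,
    ← ENNReal.mul_right_inj ha0 ha, hdual (f := fun p => g p.swap) (hg.comp measurable_swap),
    hdual (hw.mul hg)]
  exact lintegral_congr fun x =>
    hψ.sum_weight_mul_lintegral_transverse_swap (fun y s => g (y, s)) x

end IsRepresentation

section ChangeOfVariables

variable {X E : Type*} [MeasurableSpace X] [NormedAddCommGroup E] [NormedSpace ℝ E]
variable {N : Measure X} {T : X → X} {w : X → ℝ} {f : X → E}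

theorem integrable_comp_iff_of_map_eq_withDensity (hT : Measurable T) (hw : Measurable w)
    (hw0 : ∀ p, 0 ≤ w p) (hN : N.map T = N.withDensity fun p => ENNReal.ofReal (w p))
    (hf : StronglyMeasurable f) :
    Integrable (fun p => f (T p)) N ↔ Integrable (fun p => w p • f p) N := by
  refine (integrable_map_measure hf.aestronglyMeasurable hT.aemeasurable).symm.trans ?_
  rw [hN, integrable_withDensity_iff_integrable_smul' hw.ennreal_ofReal (by simp)]
  simp only [ENNReal.toReal_ofReal (hw0 _)]

theorem integral_comp_of_map_eq_withDensity (hT : Measurable T) (hw : Measurable w)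
    (hw0 : ∀ p, 0 ≤ w p) (hN : N.map T = N.withDensity fun p => ENNReal.ofReal (w p))
    (hf : StronglyMeasurable f) : ∫ p, f (T p) ∂N = ∫ p, w p • f p ∂N := by
  rw [← integral_map hT.aemeasurable hf.aestronglyMeasurable, hN,
    integral_withDensity_eq_integral_toReal_smul hw.ennreal_ofReal (by simp)]
  simp only [ENNReal.toReal_ofReal (hw0 _)]

end ChangeOfVariables

namespace IsRepresentation

variable {d : ℕ} {r : Setoid (SymbolicSpace d)} {k : Fin d → ℕ}
  {ψ : (j : Fin d) → Fin (k j) → C(SymbolicSpace d, SymbolicSpace d)}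

open scoped ProbabilityTheory

theorem lintegral_enorm_transverse_eq (hψ : IsRepresentation r ψ) {M : Measure (SymbolicSpace d)}
    [SFinite M] {F : SymbolicSpace d × SymbolicSpace d → ℝ} (hF : Measurable F)
    {u : SymbolicSpace d → SymbolicSpace d → ℝ} (hFu : ∀ x s, r s x → u s x = F (x, s)) :
    ∫⁻ x, ∫⁻ s, ‖u s x‖ₑ ∂transverse r x ∂M = ∫⁻ p, ‖F p‖ₑ ∂(M ⊗ₘ hψ.transverseKernel) := by
  rw [Measure.lintegral_compProd hF.enorm]
  refine lintegral_congr fun x => lintegral_congr_ae ?_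
  filter_upwards [hψ.ae_transverse_rel x] with s hs
  rw [hFu x s hs]

theorem integral_transverse_eq (hψ : IsRepresentation r ψ) {M : Measure (SymbolicSpace d)}
    [SFinite M] {F : SymbolicSpace d × SymbolicSpace d → ℝ}
    (hF : Integrable F (M ⊗ₘ hψ.transverseKernel))
    {u : SymbolicSpace d → SymbolicSpace d → ℝ} (hFu : ∀ x s, r s x → u s x = F (x, s)) :
    ∫ x, ∫ s, u s x ∂transverse r x ∂M = ∫ p, F p ∂(M ⊗ₘ hψ.transverseKernel) := by
  rw [Measure.integral_compProd hF]
  refine integral_congr_ae (Filter.Eventually.of_forall fun x => integral_congr_ae ?_)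
  filter_upwards [hψ.ae_transverse_rel x] with s hs
  exact hFu x s hs

theorem isQuasiInvariant (hψ : IsRepresentation r ψ) {V : C(SymbolicSpace d, ℝ)}
    {c : SymbolicSpace d → SymbolicSpace d → ℝ} (hc : IsSeparableCocycle r c V) {β : ℝ}
    {M : ProbabilityMeasure (SymbolicSpace d)} {a : ℝ≥0∞} (ha0 : a ≠ 0) (ha : a ≠ ∞)
    (hM : (haarIFS ψ V β).dualTransfer M = a • (M : Measure (SymbolicSpace d))) :
    IsQuasiInvariant r c β M := by
  intro h hh hfin
  obtain ⟨H, hH, hHh⟩ :=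
    (MeasurableEmbedding.subtype_coe hψ.measurableSet_rel).exists_measurable_extend hh fun _ => ⟨0⟩
  have hHrel (y s : SymbolicSpace d) (hys : r y s) : h y s = H (y, s) :=
    (congrFun hHh ⟨(y, s), hys⟩).symm
  have hleft (x s : SymbolicSpace d) (hs : r s x) : h s x = H (Prod.swap (x, s)) := hHrel s x hs
  have hright (x s : SymbolicSpace d) (hs : r s x) :
      h x s * Real.exp (-β * c x s) = gibbsCocycle V β (x, s) • H (x, s) := by
    rw [hHrel x s (r.symm hs), hc x s (r.symm hs), gibbsCocycle, smul_eq_mul, mul_comm]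
  have hw := measurable_gibbsCocycle V β
  have hw0 (p : SymbolicSpace d × SymbolicSpace d) : 0 ≤ gibbsCocycle V β p := (Real.exp_pos _).le
  have hN := hψ.map_swap_compProd_transverseKernel ha0 ha hM
  rw [hψ.lintegral_enorm_transverse_eq (hH.comp measurable_swap) hleft] at hfin
  have hint : Integrable (fun p => H p.swap) ((M : Measure _) ⊗ₘ hψ.transverseKernel) :=
    ⟨(hH.comp measurable_swap).aestronglyMeasurable, hfin⟩
  have hint' := (integrable_comp_iff_of_map_eq_withDensity measurable_swap hw hw0 hN
    hH.stronglyMeasurable).1 hint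
  refine ⟨?_, ?_⟩
  · rw [hψ.lintegral_enorm_transverse_eq (hw.smul hH) hright]
    exact hint'.hasFiniteIntegral
  · rw [hψ.integral_transverse_eq hint hleft, hψ.integral_transverse_eq hint' hright]
    exact integral_comp_of_map_eq_withDensity measurable_swap hw hw0 hN hH.stronglyMeasurable

end IsRepresentation

theorem mainTheorem3 (d : ℕ) (hd : 0 < d) (θ : ℝ) (hθ0 : 0 < θ) (hθ1 : θ < 1)
    (r : Setoid (SymbolicSpace d)) (k : Fin d → ℕ)
    (ψ : (j : Fin d) → Fin (k j) → C(SymbolicSpace d, SymbolicSpace d))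
    (hψ : IsRepresentation r ψ)
    (hLip : ∃ L : ℝ, 0 ≤ L ∧ L < 1 ∧ ∀ (j : Fin d) (i : Fin (k j)) (x z : SymbolicSpace d),
      symDist θ (ψ j i x) (ψ j i z) ≤ L * symDist θ x z)
    (V : C(SymbolicSpace d, ℝ)) (α : ℝ) (hα : 0 < α)
    (hV : ∃ C : ℝ, ∀ x z : SymbolicSpace d, |V x - V z| ≤ C * symDist θ x z ^ α)
    (c : SymbolicSpace d → SymbolicSpace d → ℝ) (hc : IsSeparableCocycle r c V) (β : ℝ) :
    (haarIFS ψ V β).IsContractive (symDist θ) ∧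
    (haarIFS ψ V β).HasDiniWeights (symDist θ) ∧
    (∃! K : TopologicalSpace.NonemptyCompacts (SymbolicSpace d), (haarIFS ψ V β).IsAttractor K) ∧
    ∀ (K : TopologicalSpace.NonemptyCompacts (SymbolicSpace d)) (hK : (haarIFS ψ V β).IsAttractor K),
      0 < ((haarIFS ψ V β).restrict K hK).rho ∧
      (∃! p : C(K, ℝ) × ProbabilityMeasure K,
        ((haarIFS ψ V β).restrict K hK).IsPerronPair p.1 p.2) ∧
      ∀ (h : C(K, ℝ)) (μ : ProbabilityMeasure K),
        ((haarIFS ψ V β).restrict K hK).IsPerronPair h μ →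
        IsQuasiInvariant r c β (μ.map measurable_subtype_coe.aemeasurable) := by
  obtain ⟨L, hL0, hL1, hL⟩ := hLip
  obtain ⟨C, hC⟩ := hV
  have : Nonempty (SymbolicSpace d) := ⟨fun _ => ⟨0, hd⟩⟩
  have hR : (haarIFS ψ V β).IsContractive (symDist θ) := ⟨L, hL0, hL1, fun p => hL p.1 p.2⟩
  have hDini : (haarIFS ψ V β).HasDiniWeights (symDist θ) :=
    WeightedIFS.hasDiniWeights_of_abs_log_weight_sub_le (isUnitGauge_symDist hθ0.le hθ1.le) hα
      (by positivity)
      (abs_log_haarIFS_weight_sub_le hθ0.le hθ1.le hL1.le (fun p => hL p.1 p.2) hα.le hC)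
  refine ⟨hR, hDini, hψ.existsUnique_isAttractor hθ0 hθ1.le hR, fun K hK => ?_⟩
  have : Nonempty ((j : Fin d) × Fin (k j)) := hψ.nonempty_index
  have : HasOuterApproxClosed K := hasOuterApproxClosed_nonemptyCompacts K
  obtain ⟨A, hA⟩ := exists_contractsDistortion_restrict_haarIFS hθ0.le hθ1.le hL0 hL1
    (fun p => hL p.1 p.2) hα hC hK
  obtain ⟨hρ, hpair⟩ := hA.rho_pos_and_existsUnique_isPerronPair
    (separatesPoints_gaugeLipschitz_symDist_rpow continuous_subtype_val Subtype.val_injective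
      hθ0 hθ1.le hα.le)
  exact ⟨hρ, hpair, fun h μ hp => hψ.isQuasiInvariant hc (ENNReal.ofReal_pos.2 hρ).ne'
    ENNReal.ofReal_ne_top hp.dualTransfer_map_val⟩
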